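/- Let $n,N,\ell>1$ be integers that are functions of a parameter $\kappa\in\mathbb N$. For a weight $f:\mathbb Z\to\mathbb R$, $0<\sum_j f(j)^2<\infty$, the problem $\mathrm{EDCP}_{n,N,f}^{\ell}$ is to find $\mathbf s\in\mathbb Z_N^n$ from $\ell$ states, proportional to $$\sum_{j\in\mathbb Z} f(j)\,|j\rangle\,|\mathbf x_k+j\mathbf s \bmod N\rangle\qquad(k\le\ell),$$ with arbitrary $\mathbf x_k\in\mathbb Z_N^n$. It is called $\mathrm{G\text{-}EDCP}_{n,N,r}^{\ell}$ for $f(j)=\exp(-\pi j^2/r^2)$, $r>0$ real, and $\mathrm{U\text{-}EDCP}_{n,N,M}^{\ell}$ for the indicator function $f$ of $\{0,\dots,M-1\}$, $M\ge 1$ an integer. A solver of $\mathrm{EDCP}_{n,N,f}^{\ell}$ has success probability (at least) $\varepsilon$ if for every $\mathbf s$ and all $\mathbf x_1,\dots,\mathbf x_\ell$ it outputs $\mathbf s$ with probability at least $\varepsilon$; it solves the problem if $\varepsilon\ge C\,(n\log N)^{-d}$ for some constants $C,d>0$ and all large $\kappa$. **Lemma (EDCP self-reduction).** Let $c$ be a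 constant and let $r_1>r_2>0$ be functions of $\kappa$ with $r_1/r_2=O(\kappa^c)$ (real numbers in the Gaussian case, integers in the uniform case). Assume that the instances have polynomial size, i.e. that $\ell$, $n\log N$ and $\log r_1$ are bounded above by polynomials in $\kappa$. Let $\ell'$ be any function of $\kappa$ with values in the non-negative integers and $\ell'=O(\ell/\kappa^{c+1})$. Then there is a probabilistic quantum reduction with run-time polynomial in $\kappa$ from $\mathrm{G\text{-}EDCP}_{n,N,r_1}^{\ell}$ to $\mathrm{G\text{-}EDCP}_{n,N,r_2}^{\ell'}$, and likewise one from $\mathrm{U\text{-}EDCP}_{n,N,r_1}^{\ell}$ to $\mathrm{U\text{-}EDCP}_{n,N,r_2}^{\ell'}$. Here a reduction is one program, the same for all $\kappa$, which receives $\kappa,n,N,\ell,\ell',r_1,r_2$ and the $\ell$ input states and designates $\ell'$ registers of its memory; a solver of the target problem is then run once on these registers, and its answer is the answer. The program computes exactly with real numbers (the arithmetic operations, comparisons, $\pi$, $\exp$, $\log$ and $\arccos$ at unit cost, without real constants), and its quantum steps are one-qubit unitaries controlled by a constant number of qubits and one-qubit measurements. There is a constant $a>0$ such that, for all large $\kappa$,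 every solver (an arbitrary measurement, used as a black box) of success probability $\varepsilon$ for the target problem yields success probability at least $\varepsilon-2^{-a\kappa}$ for the source problem. In particular, if the solvers solve the target problem, then the resulting algorithm solves the source problem. -/

import Mathlib

open Filter Topology Asymptotics

noncomputable section

namespace EDCP

/-! ### The extrapolated dihedral coset problem -/

/-- Labels `(j, v)` of the computational basis states `|j⟩|v⟩` of one sample. -/
abbrev Sample (n N : ℕ) : Type := ℤ × (Fin n → ZMod N)

/-- Labels of the computational basis states of `ℓ` samples. -/
abbrev Samples (n N ℓ : ℕ) : Type := Fin ℓ → Sample n N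

/-- The Gaussian weight `ρ_r(j) = exp(-π j² / r²)`. -/
def gaussian (r : ℝ) (j : ℤ) : ℝ := Real.exp (-Real.pi * (j : ℝ) ^ 2 / r ^ 2)

/-- The weight of the uniform distribution on `{0, …, M - 1}`, up to normalization. -/
def uniform (M : ℕ) (j : ℤ) : ℝ := if 0 ≤ j ∧ j < (M : ℤ) then 1 else 0

/-- The weight function `f`, normalized to a unit vector of `ℓ²(ℤ)`. -/
def amplitude (f : ℤ → ℝ) (j : ℤ) : ℝ := f j / √(∑' i : ℤ, f i ^ 2)

/-- The input with secret `s` and offsets `x`: the tensor product over `k < ℓ` of the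
normalized states `∑ j, f(j) |j⟩|x_k + j • s⟩`, given by its coefficients. -/
def state {n N ℓ : ℕ} (f : ℤ → ℝ) (s : Fin n → ZMod N) (x : Fin ℓ → Fin n → ZMod N) :
    Samples n N ℓ → ℂ :=
  fun y => ∏ k, if (y k).2 = x k + (y k).1 • s then (amplitude f (y k).1 : ℂ) else 0

/-- A vector of `ℓ²(I)` from its coefficients (`0` if they are not square summable). -/
def toL2 {I : Type} (f : I → ℂ) : lp (fun _ : I => ℂ) 2 :=
  open Classical in if h : Memℓp f 2 then ⟨f, h⟩ else 0

/-- A solver: an arbitrary quantum measurement of the `ℓ` input samples whose outcome is a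
candidate for the secret. The effects sum up to at most the identity, the rest being the
probability of giving no answer. -/
structure Solver (n N ℓ : ℕ) where
  effect : (Fin n → ZMod N) →
    (lp (fun _ : Samples n N ℓ => ℂ) 2 →L[ℂ] lp (fun _ : Samples n N ℓ => ℂ) 2)
  pos : ∀ s, (effect s).IsPositive
  sum_le : ∀ S : Finset (Fin n → ZMod N), (1 - ∑ s ∈ S, effect s).IsPositive

/-- The probability of the outcome `s` on the vector with coefficients `ψ`, which is
multiplied by the squared norm of that vector if it is not a unit vector. -/
def Solver.prob {n N ℓ : ℕ} (O : Solver n N ℓ) (s : Fin n → ZMod N)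
    (ψ : Samples n N ℓ → ℂ) : ℝ :=
  (O.effect s).reApplyInnerSelf (toL2 ψ)

/-- The solver outputs the secret with probability at least `ε`, for every secret and
arbitrary offsets. -/
def Solver.SolvesWith {n N ℓ : ℕ} (O : Solver n N ℓ) (f : ℤ → ℝ) (ε : ℝ) : Prop :=
  ∀ (s : Fin n → ZMod N) (x : Fin ℓ → Fin n → ZMod N), ε ≤ O.prob s (state f s x)

/-! ### Quantum programs

A random access machine over the real numbers controls an array of qubits. -/

/-- The address of a qubit: block, register in the block, position in the register. -/
abbrev Qubit : Type := ℕ × ℕ × ℕ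

/-- The computational basis of the quantum memory. -/
abbrev Bits : Type := Qubit → Bool

/-- Real expressions over the classical memory. -/
inductive Expr : Type
  | nat (k : ℕ)
  | pi
  | cell (a : Expr)
  | add (a b : Expr)
  | sub (a b : Expr)
  | mul (a b : Expr)
  | div (a b : Expr)
  | exp (a : Expr)
  | log (a : Expr)
  | arccos (a : Expr)

/-- The value of an expression. Addresses are rounded down to natural numbers. -/
def Expr.val (m : ℕ → ℝ) : Expr → ℝ
  | .nat k => k
  | .pi => Real.pi
  | .cell a => m ⌊a.val m⌋₊
  | .add a b => a.val m + b.val m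
  | .sub a b => a.val m - b.val m
  | .mul a b => a.val m * b.val m
  | .div a b => a.val m / b.val m
  | .exp a => Real.exp (a.val m)
  | .log a => Real.log (a.val m)
  | .arccos a => Real.arccos (a.val m)

/-- The value of an expression that is used as an address or as a number of repetitions. -/
def Expr.addr (m : ℕ → ℝ) (e : Expr) : ℕ := ⌊e.val m⌋₊

/-- A qubit whose address is computed at run time. -/
structure QubitExpr : Type where
  block : Expr
  reg : Expr
  pos : Expr

def QubitExpr.addr (m : ℕ → ℝ) (q : QubitExpr) : Qubit :=
  (q.block.addr m, q.reg.addr m, q.pos.addr m)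

/-- Programs. A program is a finite text without real constants.
* `assign a e`: write the value of `e` to the classical cell `a`;
* `gate α θ φ ω q ctrl`: apply a one-qubit gate to `q`, controlled by the qubits `ctrl`;
* `measure q a`: measure `q` and write the outcome, `0` or `1`, to the classical cell `a`;
* `emit e`: append the block number `e` to the output list;
* `ite e₁ e₂ P Q`: run `P` if `e₁ ≤ e₂` and `Q` otherwise;
* `loop e P`: run `P` as many times as `e` says on entry. -/
inductive Prog : Type
  | assign (a e : Expr)
  | gate (α θ φ ω : Expr) (q : QubitExpr) (ctrl : List QubitExpr)
  | measure (q : QubitExpr) (a : Expr)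
  | emit (e : Expr)
  | seq (P Q : Prog)
  | ite (e₁ e₂ : Expr) (P Q : Prog)
  | loop (e : Expr) (P : Prog)

/-- A configuration on one branch of the measurement outcomes. The squared norm of the
quantum state `amp` is the probability of the branch. -/
structure Config : Type where
  mem : ℕ → ℝ
  out : List ℕ
  amp : Bits → ℂ
  time : ℕ

/-- Entry (row, column) of the general unitary `2 × 2` matrix
`e^{iα} [[cos θ, -e^{iω} sin θ], [e^{iφ} sin θ, e^{i(φ+ω)} cos θ]]`. -/
def gateEntry (α θ φ ω : ℝ) : Bool → Bool → ℂ
  | false, false => Complex.exp (Complex.I * α) * Real.cos θ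
  | false, true => -(Complex.exp (Complex.I * (α + ω)) * Real.sin θ)
  | true, false => Complex.exp (Complex.I * (α + φ)) * Real.sin θ
  | true, true => Complex.exp (Complex.I * (α + φ + ω)) * Real.cos θ

/-- The action of a gate with matrix `U` on the qubit `q`, controlled by the qubits `ctrl`
(no action if `q` is one of its own controls). -/
def applyGate (U : Bool → Bool → ℂ) (q : Qubit) (ctrl : List Qubit) (ψ : Bits → ℂ) :
    Bits → ℂ :=
  open Classical in fun b =>
    if q ∉ ctrl ∧ ∀ p ∈ ctrl, b p = true then
      U (b q) false * ψ (Function.update b q false) + U (b q) true * ψ (Function.update b q true)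
    else ψ b

/-- The unnormalized state after the qubit `q` was measured with outcome `v`. -/
def project (q : Qubit) (v : Bool) (ψ : Bits → ℂ) : Bits → ℂ :=
  fun b => if b q = v then ψ b else 0

/-- Let `t` units of time pass. -/
def Config.tick (c : Config) (t : ℕ) : Config := { c with time := c.time + t }

/-- The list of the configurations in which the program can end, one for each sequence of
measurement outcomes. Every executed instruction, every test and every iteration takes one
unit of time, and every control qubit of a gate takes one more. -/
def Prog.run : Prog → Config → List Config
  | .assign a e, c =>
      [{ c.tick 1 with mem := Function.update c.mem (a.addr c.mem) (e.val c.mem) }]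
  | .gate α θ φ ω q ctrl, c =>
      [{ c.tick (1 + ctrl.length) with
          amp := applyGate
            (gateEntry (α.val c.mem) (θ.val c.mem) (φ.val c.mem) (ω.val c.mem))
            (q.addr c.mem) (ctrl.map (QubitExpr.addr c.mem)) c.amp }]
  | .measure q a, c =>
      [false, true].map fun v =>
        { c.tick 1 with
          mem := Function.update c.mem (a.addr c.mem) (if v = true then 1 else 0)
          amp := project (q.addr c.mem) v c.amp }
  | .emit e, c => [{ c.tick 1 with out := c.out ++ [e.addr c.mem] }]
  | .seq P Q, c => (P.run c).flatMap Q.run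
  | .ite e₁ e₂ P Q, c =>
      open Classical in
      if e₁.val c.mem ≤ e₂.val c.mem then P.run (c.tick 1) else Q.run (c.tick 1)
  | .loop e P, c =>
      (fun L : List Config => L.flatMap fun d => P.run (d.tick 1))^[e.addr c.mem] [c.tick 1]

/-! ### Reductions -/

/-- The qubits that store the basis state `|j⟩|v⟩`. Register `0` holds `j` by its sign and
the binary digits of `|j|`, register `t + 1` holds the binary digits of the representative
of `v t` in `{0, …, N - 1}`. -/
def encodeSample {n N : ℕ} (y : Sample n N) : ℕ × ℕ → Bool
  | (0, 0) => decide (y.1 < 0)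
  | (0, i + 1) => y.1.natAbs.testBit i
  | (t + 1, i) => if h : t < n then (y.2 ⟨t, h⟩).val.testBit i else false

/-- Sample `k < ℓ` is stored in block `k`. All other qubits are `0`. -/
def encode {n N ℓ : ℕ} (y : Samples n N ℓ) : Bits :=
  fun q => if h : q.1 < ℓ then encodeSample (y ⟨q.1, h⟩) q.2 else false

/-- The initial configuration: the classical cells `0, …, 6` hold
`κ, n, N, ℓ₁, ℓ₂, p₁, p₂`, and the quantum memory holds the state `ψ` of `ℓ₁` samples. -/
def initial (κ n N ℓ₁ ℓ₂ : ℕ) (p₁ p₂ : ℝ) (ψ : Samples n N ℓ₁ → ℂ) : Config where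
  mem := fun i => match i with
    | 0 => κ
    | 1 => n
    | 2 => N
    | 3 => ℓ₁
    | 4 => ℓ₂
    | 5 => p₁
    | 6 => p₂
    | _ => 0
  out := []
  amp := Function.extend encode ψ 0
  time := 0

/-- The contents `b` of the memory, with the samples `y` written to the blocks of `out`. -/
def place {n N ℓ : ℕ} (out : List ℕ) (y : Samples n N ℓ) (b : Bits) : Bits :=
  fun q => if h : out.idxOf q.1 < ℓ then encodeSample (y ⟨out.idxOf q.1, h⟩) q.2 else b q

/-- The probability to end in the branch `c` and to obtain the answer `s` from the solver
when it is run on the blocks listed in `c.out`: the sum over the basis states `b` of the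
rest of the memory. The output is void unless it lists exactly `ℓ` different blocks. -/
def Solver.branchProb {n N ℓ : ℕ} (O : Solver n N ℓ) (s : Fin n → ZMod N) (c : Config) : ℝ :=
  open Classical in
  if c.out.length = ℓ ∧ c.out.Nodup then
    ∑' b : {b : Bits // ∀ k ∈ c.out, ∀ i, b (k, i) = false},
      O.prob s fun y => c.amp (place c.out y b.1)
  else 0

/-- The program `R`, followed by one call of the solver `O` on the samples that `R` outputs,
answers with the secret with probability at least `ε`, for every secret and arbitrary
offsets. -/
def Prog.SolvesUsing {n N ℓ₂ : ℕ} (R : Prog) (O : Solver n N ℓ₂) (κ ℓ₁ : ℕ) (p₁ p₂ : ℝ)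
    (f : ℤ → ℝ) (ε : ℝ) : Prop :=
  ∀ (s : Fin n → ZMod N) (x : Fin ℓ₁ → Fin n → ZMod N),
    ε ≤ ((R.run (initial κ n N ℓ₁ ℓ₂ p₁ p₂ (state f s x))).map (O.branchProb s)).sum

/-- Bounded above by a polynomial in `κ`. -/
def PolyBounded (g : ℕ → ℝ) : Prop :=
  ∃ P : Polynomial ℕ, ∀ κ, g κ ≤ (P.eval κ : ℕ)

/-- `S κ ε` (success with probability at least `ε`) holds with an `ε` that is at least
inverse polynomial in `n log N`. -/
def InversePoly (n N : ℕ → ℕ) (S : ℕ → ℝ → Prop) : Prop :=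
  ∃ C : ℝ, 0 < C ∧ ∃ d : ℕ, ∀ᶠ κ in atTop,
    S κ (C * ((n κ : ℝ) * Real.log (N κ))⁻¹ ^ d)

/-- A quantum reduction with run-time polynomial in `κ`, from the problem with `ℓ₁` samples
of weight `f (p₁ κ)` to the problem with `ℓ₂` samples of weight `f (p₂ κ)`. One program
serves for all `κ`. It turns every solver of success probability `ε` into one of success
probability `ε - 2^{-Ω(κ)}`, and solvers of inverse polynomial success probability into such
solvers. -/
def PolyTimeReduction {α : Type} (toReal : α → ℝ) (f : α → ℤ → ℝ) (n N ℓ₁ ℓ₂ : ℕ → ℕ)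
    (p₁ p₂ : ℕ → α) : Prop :=
  ∃ R : Prog,
    (∃ T : Polynomial ℕ, ∀ κ (s : Fin (n κ) → ZMod (N κ))
      (x : Fin (ℓ₁ κ) → Fin (n κ) → ZMod (N κ)),
      ∀ c ∈ R.run (initial κ (n κ) (N κ) (ℓ₁ κ) (ℓ₂ κ) (toReal (p₁ κ)) (toReal (p₂ κ))
        (state (f (p₁ κ)) s x)), c.time ≤ T.eval κ) ∧
    (∃ a : ℝ, 0 < a ∧ ∀ᶠ κ : ℕ in atTop, ∀ (O : Solver (n κ) (N κ) (ℓ₂ κ)) (ε : ℝ),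
      O.SolvesWith (f (p₂ κ)) ε →
      R.SolvesUsing O κ (ℓ₁ κ) (toReal (p₁ κ)) (toReal (p₂ κ)) (f (p₁ κ))
        (ε - (2 : ℝ) ^ (-(a * κ)))) ∧
    (∀ O : ∀ κ, Solver (n κ) (N κ) (ℓ₂ κ),
      InversePoly n N (fun κ ε => (O κ).SolvesWith (f (p₂ κ)) ε) →
      InversePoly n N (fun κ ε =>
        R.SolvesUsing (O κ) κ (ℓ₁ κ) (toReal (p₁ κ)) (toReal (p₂ κ)) (f (p₁ κ)) ε))

end EDCP

end

noncomputable section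

namespace EDCP

/-! ### Product states -/

/-! Each input sample is filtered by itself. A measurement multiplies the amplitude of `|j⟩` by a
factor in `[0, 1]` that turns the wide weight into the narrow one; the ray `x + j • s`, hence the
secret, is untouched. If the measurement fails, the sample is dropped. The success probability of
one filter is the ratio `p` of the squared norms of the weights. It is `M₂ / M₁` in the uniform
case, and at least `r₂ / r₁` in the Gaussian case by Poisson summation (`tsum_gaussian_sq_le`).

Since `1 / p = O(κ ^ c)` and `ℓ' = O(ℓ / κ ^ (c + 1))`, the expected number `p ℓ` of successes
exceeds `ℓ'` by a factor of order `κ`. An exponential moment bound (`chance`,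
`eventually_one_sub_chance_le`) makes fewer than `ℓ'` successes exponentially unlikely.

The Gaussian factor is `exp(-π δ j²)` with `δ = 1/r₂² - 1/r₁²`. Expanding `j²` over pairs of binary
digits makes it a product of damping steps, each a doubly controlled rotation of an ancilla by an
`arccos` followed by a measurement (`prod_pairFactor`, `gaussianFilter_isFilter`). Only finitely
many digits are treated, so the weight produced differs from `gaussian r₂` in the far tail; by
`Solver.prob_state_le` this costs an exponentially small part of the success probability. The
uniform filter compares `|j|` with `M₂ - 1` by a ripple of carries, measures the last carry and
uncomputes the others (`uniformFilter_isFilter`); it is exact.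

Programs are evaluated backwards: `branchSum` gives the value before a program from the value `V`
after it. `IsProduct` records that the relevant blocks are unentangled with the rest, so that a
filter may be analysed on one block; `IsFilter` states its effect for an arbitrary continuation.
`IsFilter.sampler` combines the filters by induction over the samples, and `Tame.run_le` with the
cost estimates bounds the time on every branch. -/

/-- The computational basis of one block of the memory. -/
abbrev Block : Type := ℕ × ℕ → Bool

/-- The contents of block `k`. -/
def blk (k : ℕ) (b : Bits) : Block := fun i => b (k, i)

/-- Overwrite block `k`. -/
def setBlk (k : ℕ) (β : Block) (b : Bits) : Bits := fun q => if q.1 = k then β q.2 else b q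

@[simp] lemma blk_setBlk_self (k : ℕ) (β : Block) (b : Bits) : blk k (setBlk k β b) = β := by
  funext i; simp [blk, setBlk]

lemma blk_setBlk_of_ne {k i : ℕ} (h : i ≠ k) (β : Block) (b : Bits) :
    blk i (setBlk k β b) = blk i b := by
  funext j; simp [blk, setBlk, h]

lemma blk_update_self (k : ℕ) (q : ℕ × ℕ) (v : Bool) (b : Bits) :
    blk k (Function.update b (k, q) v) = Function.update (blk k b) q v := by
  funext i
  by_cases h : i = q
  · subst h; simp [blk]
  · simp [blk, h]

lemma blk_update_of_ne {k i : ℕ} (h : i ≠ k) (q : ℕ × ℕ) (v : Bool) (b : Bits) :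
    blk i (Function.update b (k, q) v) = blk i b := by
  funext j; simp [blk, h]

lemma hasSum_of_eq {ι : Type*} {f g : ι → ℝ} {a : ℝ} (h : HasSum g a) (hfg : ∀ i, f i = g i) :
    HasSum f a := by
  rwa [funext hfg]

/-- The blocks in `S` are in the states `ξ`, independently of the rest of the memory, which is
in a state of squared norm `w`. -/
def IsProduct (S : Finset ℕ) (ξ : ℕ → Block → ℂ) (w : ℝ) (ψ : Bits → ℂ) : Prop :=
  ∃ φ : Bits → ℂ, (∀ b b', (∀ k ∉ S, blk k b = blk k b') → φ b = φ b') ∧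
    HasSum (fun b : {b : Bits // ∀ k ∈ S, ∀ i, b (k, i) = false} => ‖φ b‖ ^ 2) w ∧
    ∀ b, ψ b = φ b * ∏ k ∈ S, ξ k (blk k b)

lemma IsProduct.nonneg {S : Finset ℕ} {ξ : ℕ → Block → ℂ} {w : ℝ} {ψ : Bits → ℂ}
    (h : IsProduct S ξ w ψ) : 0 ≤ w := by
  obtain ⟨φ, -, h, -⟩ := h
  exact h.nonneg fun _ => by positivity

lemma IsProduct.congr {S : Finset ℕ} {ξ ξ' : ℕ → Block → ℂ} {w : ℝ} {ψ : Bits → ℂ}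
    (h : IsProduct S ξ w ψ) (h' : ∀ k ∈ S, ξ k = ξ' k) : IsProduct S ξ' w ψ := by
  obtain ⟨φ, h1, h2, h3⟩ := h
  refine ⟨φ, h1, h2, fun b => ?_⟩
  rw [h3, Finset.prod_congr rfl fun k hk => by rw [h' k hk]]

lemma prod_update_blk {S : Finset ℕ} {k : ℕ} (hk : k ∈ S) (ξ : ℕ → Block → ℂ) (η : Block → ℂ)
    (b : Bits) : ∏ i ∈ S, Function.update ξ k η i (blk i b) =
      η (blk k b) * ∏ i ∈ S.erase k, ξ i (blk i b) := by
  rw [← Finset.mul_prod_erase S _ hk, Function.update_self]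
  congr 1
  refine Finset.prod_congr rfl fun i hi => ?_
  rw [Function.update_of_ne (Finset.ne_of_mem_erase hi)]

/-- A phase or scalar factor of one block is moved to the rest of the memory. -/
lemma IsProduct.rescale {S : Finset ℕ} {ξ : ℕ → Block → ℂ} {w : ℝ} {ψ : Bits → ℂ} {k : ℕ}
    (hk : k ∈ S) {a : ℂ} {η : Block → ℂ} (h : IsProduct S (Function.update ξ k (a • η)) w ψ) :
    IsProduct S (Function.update ξ k η) (w * ‖a‖ ^ 2) ψ := by
  obtain ⟨φ, h1, h2, h3⟩ := h
  refine ⟨fun b => φ b * a, fun b b' hb => by simp only [h1 b b' hb], ?_, fun b => ?_⟩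
  · simpa [mul_pow] using h2.mul_right (‖a‖ ^ 2)
  · rw [h3, prod_update_blk hk, prod_update_blk hk, Pi.smul_apply, smul_eq_mul]
    ring

/-- A block that is not needed any more becomes a part of the rest of the memory. -/
lemma IsProduct.discard {S : Finset ℕ} {ξ : ℕ → Block → ℂ} {w : ℝ} {ψ : Bits → ℂ} {k : ℕ}
    (hk : k ∈ S) {t : ℝ} (ht : HasSum (fun β => ‖ξ k β‖ ^ 2) t) (h : IsProduct S ξ w ψ) :
    IsProduct (S.erase k) ξ (w * t) ψ := by
  obtain ⟨φ, h1, h2, h3⟩ := h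
  refine ⟨fun b => φ b * ξ k (blk k b), fun b b' hb => ?_, ?_, fun b => ?_⟩
  · simp only [h1 b b' fun i hi => hb i fun h => hi (Finset.mem_of_mem_erase h), hb k (by simp)]
  -- A memory that vanishes on `S.erase k` is a memory that vanishes on `S` together with free
  -- contents of block `k`; the sum of the squared norms factors accordingly.
  · let e : {b : Bits // ∀ i ∈ S, ∀ q, b (i, q) = false} × Block ≃
        {b : Bits // ∀ i ∈ S.erase k, ∀ q, b (i, q) = false} :=
      { toFun := fun x => ⟨setBlk k x.2 x.1, fun i hi q => by
          simp [setBlk, Finset.ne_of_mem_erase hi, x.1.2 i (Finset.mem_of_mem_erase hi) q]⟩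
        invFun := fun b => (⟨setBlk k (fun _ => false) b, fun i hi q => by
          by_cases hik : i = k
          · simp [setBlk, hik]
          · simp [setBlk, hik, b.2 i (Finset.mem_erase.2 ⟨hik, hi⟩) q]⟩, blk k b)
        left_inv := fun x => by
          refine Prod.ext (Subtype.ext ?_) (by simp)
          funext q
          by_cases hq : q.1 = k
          · subst hq
            simp [setBlk, x.1.2 q.1 hk q.2]
          · simp [setBlk, hq]
        right_inv := fun b => by
          refine Subtype.ext ?_
          funext q
          by_cases hq : q.1 = k
          · simp [setBlk, blk, ← hq]
          · simp [setBlk, hq] }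
    rw [← e.hasSum_iff]
    have := h2.mul ht (h2.summable.mul_of_nonneg ht.summable (fun _ => by positivity)
      fun _ => by positivity)
    refine hasSum_of_eq this fun x => ?_
    have hφ : φ (setBlk k x.2 x.1) = φ x.1 := h1 _ _ fun i hi =>
      blk_setBlk_of_ne (ne_of_mem_of_not_mem hk hi).symm _ _
    simp [e, hφ, mul_pow]
  · rw [h3, ← Finset.mul_prod_erase S _ hk]
    ring

/-- The action of a gate inside one block. -/
def applyLocal (U : Bool → Bool → ℂ) (q : ℕ × ℕ) (ctrl : List (ℕ × ℕ)) (η : Block → ℂ) :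
    Block → ℂ :=
  open Classical in fun β =>
    if q ∉ ctrl ∧ ∀ p ∈ ctrl, β p = true then
      U (β q) false * η (Function.update β q false) + U (β q) true * η (Function.update β q true)
    else η β

/-- The measurement of a qubit inside one block. -/
def projectLocal (q : ℕ × ℕ) (v : Bool) (η : Block → ℂ) : Block → ℂ :=
  fun β => if β q = v then η β else 0

/-- Target and controls lie in block `k`, so `φ` and the other factors take the same values at all
the arguments that the gate mixes. -/
lemma IsProduct.applyGate {S : Finset ℕ} {ξ : ℕ → Block → ℂ} {w : ℝ} {ψ : Bits → ℂ} {k : ℕ}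
    (hk : k ∈ S) {η : Block → ℂ} (h : IsProduct S (Function.update ξ k η) w ψ)
    (U : Bool → Bool → ℂ) (q : ℕ × ℕ) (ctrl : List (ℕ × ℕ)) :
    IsProduct S (Function.update ξ k (applyLocal U q ctrl η)) w
      (applyGate U (k, q) (ctrl.map fun p => (k, p)) ψ) := by
  obtain ⟨φ, h1, h2, h3⟩ := h
  refine ⟨φ, h1, h2, fun b => ?_⟩
  have hφ (v : Bool) : φ (Function.update b (k, q) v) = φ b := h1 _ _ fun i hi =>
    blk_update_of_ne (ne_of_mem_of_not_mem hk hi).symm _ _ _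
  have hp (v : Bool) : ∏ i ∈ S.erase k, ξ i (blk i (Function.update b (k, q) v)) =
      ∏ i ∈ S.erase k, ξ i (blk i b) := Finset.prod_congr rfl fun i hi => by
    rw [blk_update_of_ne (Finset.ne_of_mem_erase hi)]
  have hc : ((k, q) ∉ ctrl.map (fun p => (k, p)) ∧
      ∀ p ∈ ctrl.map (fun p => (k, p)), b p = true) ↔
      (q ∉ ctrl ∧ ∀ p ∈ ctrl, blk k b p = true) := by
    simp only [List.mem_map, Prod.mk.injEq, true_and, exists_eq_right, forall_exists_index,
      and_imp, forall_apply_eq_imp_iff₂]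
    rfl
  rw [prod_update_blk hk]
  unfold EDCP.applyGate applyLocal
  simp only [hc, h3, prod_update_blk hk, hφ, hp, blk_update_self]
  split_ifs
  · simp only [blk]; ring
  · rfl

lemma IsProduct.project {S : Finset ℕ} {ξ : ℕ → Block → ℂ} {w : ℝ} {ψ : Bits → ℂ} {k : ℕ}
    (hk : k ∈ S) {η : Block → ℂ} (h : IsProduct S (Function.update ξ k η) w ψ)
    (q : ℕ × ℕ) (v : Bool) :
    IsProduct S (Function.update ξ k (projectLocal q v η)) w (EDCP.project (k, q) v ψ) := by
  obtain ⟨φ, h1, h2, h3⟩ := h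
  refine ⟨φ, h1, h2, fun b => ?_⟩
  rw [prod_update_blk hk]
  simp only [EDCP.project, projectLocal, h3, prod_update_blk hk]
  change (if b (k, q) = v then _ else _) = φ b * ((if b (k, q) = v then _ else _) * _)
  split_ifs <;> simp

/-! ### States of one block -/

/-- The superposition of the basis states `e j` with coefficients `h j`. -/
def superpose (e : ℤ → Block) (h : ℤ → ℝ) : Block → ℂ :=
  Function.extend e (fun j => (h j : ℂ)) 0

lemma hasSum_superpose {e : ℤ → Block} (he : Function.Injective e) {h : ℤ → ℝ} {t : ℝ}
    (ht : HasSum (fun j => h j ^ 2) t) : HasSum (fun β => ‖superpose e h β‖ ^ 2) t := by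
  rw [← he.hasSum_iff]
  · simpa [Function.comp_def, superpose, he.extend_apply] using ht
  · intro β hβ
    rw [superpose, Function.extend_apply' _ _ _ fun ⟨j, hj⟩ => hβ ⟨j, hj⟩]
    simp

lemma superpose_smul (e : ℤ → Block) (a : ℝ) (h : ℤ → ℝ) :
    superpose e (fun j => a * h j) = (a : ℂ) • superpose e h := by
  classical
  funext β
  simp only [superpose, Function.extend_def, Pi.smul_apply, smul_eq_mul]
  split_ifs <;> simp

/-- To prove that a state is a superposition of the basis states `e j`. -/
lemma eq_superpose {e : ℤ → Block} (he : Function.Injective e) {h : ℤ → ℝ} {η : Block → ℂ}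
    (h1 : ∀ j, η (e j) = h j) (h2 : ∀ β, (∀ j, e j ≠ β) → η β = 0) : η = superpose e h := by
  funext β
  by_cases hβ : ∃ j, e j = β
  · obtain ⟨j, rfl⟩ := hβ
    rw [h1, superpose, he.extend_apply]
  · rw [h2 β fun j hj => hβ ⟨j, hj⟩, superpose, Function.extend_apply' _ _ _ hβ]
    rfl

lemma superpose_apply {e : ℤ → Block} (he : Function.Injective e) (h : ℤ → ℝ) (j : ℤ) :
    superpose e h (e j) = h j := he.extend_apply _ _ _

lemma superpose_eq_zero {e : ℤ → Block} {h : ℤ → ℝ} {β : Block} (hβ : ∀ j, e j ≠ β) :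
    superpose e h β = 0 := Function.extend_apply' _ _ _ fun ⟨j, hj⟩ => hβ j hj

variable {n N : ℕ}

/-- The block with the basis state `|j⟩|x + j • s⟩`. -/
def ray (s x : Fin n → ZMod N) (j : ℤ) : Block := encodeSample (j, x + j • s)

/-- Sign and digits of `|j|` already determine `j`, so rays are injective without any condition on
`N`. -/
lemma encodeSample_fst_inj {y y' : Sample n N} (h : encodeSample y = encodeSample y') :
    y.1 = y'.1 := by
  have h0 := congrFun h (0, 0)
  have h1 : y.1.natAbs = y'.1.natAbs := Nat.eq_of_testBit_eq fun i => congrFun h (0, i + 1)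
  simp only [encodeSample, decide_eq_decide] at h0
  omega

lemma encodeSample_injective [NeZero N] :
    Function.Injective (encodeSample : Sample n N → Block) := by
  intro y y' h
  refine Prod.ext (encodeSample_fst_inj h) (funext fun t => ZMod.val_injective N ?_)
  refine Nat.eq_of_testBit_eq fun i => ?_
  simpa [encodeSample] using congrFun h (t + 1, i)

lemma ray_injective (s x : Fin n → ZMod N) : Function.Injective (ray s x) :=
  fun _ _ h => encodeSample_fst_inj h

lemma superpose_ray_encodeSample [NeZero N] (s x : Fin n → ZMod N) (h : ℤ → ℝ)
    (y : Sample n N) :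
    superpose (ray s x) h (encodeSample y) = if y.2 = x + y.1 • s then (h y.1 : ℂ) else 0 := by
  split_ifs with hy
  · have : encodeSample y = ray s x y.1 := by rw [ray, ← hy]
    rw [this, superpose_apply (ray_injective s x)]
  · refine superpose_eq_zero fun j hj => hy ?_
    have := encodeSample_injective hj
    rw [← this]

/-! ### Input and output of a program -/

lemma encode_injective {n N ℓ : ℕ} [NeZero N] :
    Function.Injective (encode : Samples n N ℓ → Bits) := by
  intro y y' h
  funext k
  refine encodeSample_injective (funext fun i => ?_)
  simpa [encode] using congrFun h (k, i)

lemma blk_encode {n N ℓ : ℕ} (y : Samples n N ℓ) (k : Fin ℓ) :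
    blk k (encode y) = encodeSample (y k) := by
  funext i; simp [blk, encode]

/-- The input is a product state. -/
lemma isProduct_encode {n N ℓ : ℕ} [NeZero N] (f : ℤ → ℝ) (s : Fin n → ZMod N)
    (x : Fin ℓ → Fin n → ZMod N) (X : ℕ → Fin n → ZMod N) (hX : ∀ k : Fin ℓ, X k = x k) :
    IsProduct (Finset.range ℓ) (fun k => superpose (ray s (X k)) (amplitude f)) 1
      (Function.extend encode (state f s x) 0) := by
  classical
  -- The rest of the memory is in the all-zero state; its amplitude is the indicator function of
  -- that.
  refine ⟨fun b => if ∀ q : Qubit, ℓ ≤ q.1 → b q = false then 1 else 0, fun b b' h => ?_, ?_,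
    fun b => ?_⟩
  · have hq : ∀ q : Qubit, ℓ ≤ q.1 → b q = b' q := fun q hq =>
      congrFun (h q.1 (by simpa using hq)) q.2
    have : (∀ q : Qubit, ℓ ≤ q.1 → b q = false) ↔ ∀ q : Qubit, ℓ ≤ q.1 → b' q = false :=
      forall₂_congr fun q h => by rw [hq q h]
    simp only [this]
  · let b₀ : {b : Bits // ∀ k ∈ Finset.range ℓ, ∀ i, b (k, i) = false} :=
      ⟨fun _ => false, fun _ _ _ => rfl⟩
    have : HasSum _ _ := hasSum_single (f := fun b : {b : Bits // ∀ k ∈ Finset.range ℓ, ∀ i,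
      b (k, i) = false} => ‖(if ∀ q : Qubit, ℓ ≤ q.1 → b.1 q = false then 1 else 0 : ℂ)‖ ^ 2) b₀
      (fun b hb => by
        rw [if_neg]
        · simp
        · refine fun h => hb (Subtype.ext (funext fun q => ?_))
          by_cases hq : q.1 < ℓ
          · exact b.2 q.1 (by simpa using hq) q.2
          · exact h q (by omega))
    simpa [b₀] using this
  · rw [Finset.prod_range]
    by_cases hb : ∃ y : Samples n N ℓ, encode y = b
    · obtain ⟨y, rfl⟩ := hb
      have h0 : ∀ q : Qubit, ℓ ≤ q.1 → encode y q = false := fun q hq =>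
        dif_neg (not_lt.2 hq)
      rw [encode_injective.extend_apply]
      simp only [if_pos h0, one_mul, blk_encode, superpose_ray_encodeSample, hX]
      rfl
    · rw [Function.extend_apply' _ _ _ hb]
      symm
      -- A memory that encodes no samples either has a nonzero bit outside the input blocks, or has
      -- an input block that encodes no sample and therefore contributes a zero factor.
      rw [Pi.zero_apply, mul_eq_zero, or_iff_not_imp_left]
      intro h1
      rw [Finset.prod_eq_zero_iff]
      by_contra! h2
      refine hb ?_
      have h3 : ∀ k : Fin ℓ, ∃ y : Sample n N, encodeSample y = blk k b := by
        intro k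
        by_contra! h3
        exact h2 k (Finset.mem_univ _) (superpose_eq_zero fun j => h3 _)
      choose y hy using h3
      refine ⟨y, funext fun q => ?_⟩
      have h4 : ∀ q : Qubit, ℓ ≤ q.1 → b q = false := by
        by_contra h; exact h1 (if_neg h)
      by_cases hq : q.1 < ℓ
      · simpa [encode, hq, blk] using congrFun (hy ⟨q.1, hq⟩) q.2
      · simp [encode, hq, h4 q (by omega)]

/-- The default value `0` of `toL2` does no harm: for `a ≠ 0` the vectors `ψ` and `a • ψ` are square
summable together, and for `a = 0` both sides vanish. -/
lemma toL2_smul {I : Type} (a : ℂ) (ψ : I → ℂ) : toL2 (a • ψ) = a • toL2 ψ := by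
  classical
  by_cases ha : a = 0
  · subst ha
    have : Memℓp ((0 : ℂ) • ψ) 2 := by rw [zero_smul]; exact zero_memℓp
    rw [toL2, dif_pos this]
    ext i
    simp
  · by_cases h : Memℓp ψ 2
    · rw [toL2, toL2, dif_pos h, dif_pos (h.const_smul a)]
      rfl
    · rw [toL2, toL2, dif_neg h, dif_neg, smul_zero]
      intro h'
      refine h ?_
      simpa [smul_smul, inv_mul_cancel₀ ha] using h'.const_smul a⁻¹

lemma Solver.prob_smul {n N ℓ : ℕ} (O : Solver n N ℓ) (s : Fin n → ZMod N) (a : ℂ)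
    (ψ : Samples n N ℓ → ℂ) : O.prob s (a • ψ) = ‖a‖ ^ 2 * O.prob s ψ := by
  rw [Solver.prob, toL2_smul, ContinuousLinearMap.reApplyInnerSelf_smul, Solver.prob]

lemma Solver.prob_nonneg {n N ℓ : ℕ} (O : Solver n N ℓ) (s : Fin n → ZMod N)
    (ψ : Samples n N ℓ → ℂ) : 0 ≤ O.prob s ψ :=
  (O.pos s).2 _

lemma Solver.branchProb_nonneg {n N ℓ : ℕ} (O : Solver n N ℓ) (s : Fin n → ZMod N)
    (c : Config) : 0 ≤ O.branchProb s c := by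
  unfold Solver.branchProb
  split_ifs
  · exact tsum_nonneg fun _ => O.prob_nonneg _ _
  · exact le_rfl

/-- The answer of the solver on a branch that outputs samples of weight `g`. -/
lemma Solver.branchProb_eq {n N ℓ : ℕ} [NeZero N] (O : Solver n N ℓ) (s : Fin n → ZMod N)
    (c : Config) (h1 : c.out.length = ℓ) (h2 : c.out.Nodup) (X : ℕ → Fin n → ZMod N)
    (g : ℤ → ℝ) (w : ℝ)
    (h : IsProduct c.out.toFinset (fun k => superpose (ray s (X k)) (amplitude g)) w c.amp) :
    O.branchProb s c = w * O.prob s (state g s fun i : Fin ℓ => X (c.out.get (i.cast h1.symm))) := by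
  obtain ⟨φ, hφ, hw, hc⟩ := h
  rw [Solver.branchProb, if_pos ⟨h1, h2⟩]
  refine HasSum.tsum_eq ?_
  have hi (y : Samples n N ℓ) (b : Bits) (i : Fin ℓ) :
      blk (c.out.get (i.cast h1.symm)) (place c.out y b) = encodeSample (y i) := by
    funext q
    simp [blk, place, h2.idxOf_getElem]
  -- For fixed contents `b` of the rest, the vector given to the solver is a valid input scaled by
  -- `φ b`; the squared norms of these scalars add up to `w`.
  have hp (y : Samples n N ℓ) (b : Bits) : c.amp (place c.out y b) =
      φ b * state g s (fun i : Fin ℓ => X (c.out.get (i.cast h1.symm))) y := by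
    rw [hc, List.prod_toFinset _ h2]
    congr 1
    · refine hφ _ _ fun k hk => funext fun q => ?_
      have : ¬ c.out.idxOf k < ℓ := by
        rw [← h1, List.idxOf_lt_length_iff]
        simpa using hk
      simp [blk, place, this]
    · have : c.out = List.ofFn fun i : Fin ℓ => c.out.get (i.cast h1.symm) := by
        refine List.ext_get (by simp [h1]) fun i _ _ => by simp
      conv_lhs => rw [this, List.map_ofFn, List.prod_ofFn]
      unfold state
      refine Finset.prod_congr rfl fun i _ => ?_
      rw [← superpose_ray_encodeSample, ← hi y b i]
      simp only [Function.comp, ← this]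
  have := (hw.mul_right (O.prob s (state g s fun i : Fin ℓ => X (c.out.get (i.cast h1.symm)))))
  rw [← (Equiv.subtypeEquivRight (p := fun b : Bits => ∀ k ∈ c.out.toFinset, ∀ i, b (k, i) = false)
    (q := fun b : Bits => ∀ k ∈ c.out, ∀ i, b (k, i) = false) (by simp)).hasSum_iff]
  refine hasSum_of_eq this fun b => ?_
  simp only [Function.comp, hp]
  exact O.prob_smul s (φ b) _

/-! ### Sums over the branches of a program -/

/-- The sum of `V` over the branches of `P`. -/
def Prog.branchSum (P : Prog) (V : Config → ℝ) (c : Config) : ℝ := ((P.run c).map V).sum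

namespace Prog

variable (V : Config → ℝ) (c : Config)

lemma branchSum_assign (a e : Expr) : (assign a e).branchSum V c =
    V { c.tick 1 with mem := Function.update c.mem (a.addr c.mem) (e.val c.mem) } := by
  simp [branchSum, run]

lemma branchSum_gate (α θ φ ω : Expr) (q : QubitExpr) (ctrl : List QubitExpr) :
    (gate α θ φ ω q ctrl).branchSum V c =
    V { c.tick (1 + ctrl.length) with
          amp := applyGate
            (gateEntry (α.val c.mem) (θ.val c.mem) (φ.val c.mem) (ω.val c.mem))
            (q.addr c.mem) (ctrl.map (QubitExpr.addr c.mem)) c.amp } := by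
  simp [branchSum, run]

lemma branchSum_measure (q : QubitExpr) (a : Expr) : (measure q a).branchSum V c =
    V { c.tick 1 with
          mem := Function.update c.mem (a.addr c.mem) 0
          amp := project (q.addr c.mem) false c.amp } +
    V { c.tick 1 with
          mem := Function.update c.mem (a.addr c.mem) 1
          amp := project (q.addr c.mem) true c.amp } := by
  simp [branchSum, run]

lemma branchSum_emit (e : Expr) : (emit e).branchSum V c =
    V { c.tick 1 with out := c.out ++ [e.addr c.mem] } := by
  simp [branchSum, run]

lemma sum_flatMap_run (P : Prog) (L : List Config) :
    ((L.flatMap P.run).map V).sum = (L.map (P.branchSum V)).sum := by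
  induction L with
  | nil => rfl
  | cons d L ih => simp [ih, branchSum]

/-- This permits backward reasoning: the value of `Q` becomes the continuation of `P`. -/
lemma branchSum_seq (P Q : Prog) : (seq P Q).branchSum V = P.branchSum (Q.branchSum V) := by
  funext c
  rw [branchSum, run, sum_flatMap_run, branchSum]

lemma branchSum_ite_pos (e₁ e₂ : Expr) (P Q : Prog) (h : e₁.val c.mem ≤ e₂.val c.mem) :
    (ite e₁ e₂ P Q).branchSum V c = P.branchSum V (c.tick 1) := by
  simp [branchSum, run, h]

lemma branchSum_ite_neg (e₁ e₂ : Expr) (P Q : Prog) (h : ¬ e₁.val c.mem ≤ e₂.val c.mem) :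
    (ite e₁ e₂ P Q).branchSum V c = Q.branchSum V (c.tick 1) := by
  simp only [branchSum, run, if_neg h]

/-- One iteration of a loop with body `P`. -/
def iter (P : Prog) (V : Config → ℝ) (c : Config) : ℝ := P.branchSum V (c.tick 1)

/-- `run` extends a list of branches forwards, while `iter` transforms the continuation backwards.
The induction needs arbitrary lists `L`, as one iteration turns a single branch into several. -/
lemma branchSum_loop (e : Expr) (P : Prog) :
    (loop e P).branchSum V c = (P.iter^[e.addr c.mem] V) (c.tick 1) := by
  have key (m : ℕ) (L : List Config) : (((fun L : List Config =>
      L.flatMap fun d => P.run (d.tick 1))^[m] L).map V).sum = (L.map (P.iter^[m] V)).sum := by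
    induction m generalizing L with
    | zero => rfl
    | succ m ih =>
      rw [Function.iterate_succ_apply, ih, Function.iterate_succ_apply']
      induction L with
      | nil => rfl
      | cons d L ih' =>
        simp only [List.flatMap_cons, List.map_append, List.sum_append, ih', List.map_cons,
          List.sum_cons]
        rfl
  rw [branchSum, run, key]
  simp

lemma branchSum_nonneg {V : Config → ℝ} (hV : ∀ c, 0 ≤ V c) (P : Prog) (c : Config) :
    0 ≤ P.branchSum V c :=
  List.sum_nonneg (by simpa using fun d _ => hV d)

/-! ### Run-time -/

/-- The program writes to no cell below `7`, and the numbers of iterations of its loops depend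
on the cells below `7` only. -/
def Tame : Prog → Prop
  | assign a _ => ∀ m, 7 ≤ a.addr m
  | gate .. => True
  | measure _ a => ∀ m, 7 ≤ a.addr m
  | emit _ => True
  | seq P Q => P.Tame ∧ Q.Tame
  | ite _ _ P Q => P.Tame ∧ Q.Tame
  | loop e P => (∀ m m', (∀ i < 7, m i = m' i) → e.addr m = e.addr m') ∧ P.Tame

/-- An upper bound for the run-time of a tame program. -/
def cost (m : ℕ → ℝ) : Prog → ℕ
  | assign _ _ => 1
  | gate _ _ _ _ _ ctrl => 1 + ctrl.length
  | measure _ _ => 1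
  | emit _ => 1
  | seq P Q => P.cost m + Q.cost m
  | ite _ _ P Q => 1 + (P.cost m + Q.cost m)
  | loop e P => 1 + e.addr m * (1 + P.cost m)

/-- The cells below `7` keep their input values on every branch, so no measurement outcome can
change a number of iterations, and `cost` may be evaluated in the initial memory. -/
lemma Tame.run_le {m : ℕ → ℝ} {P : Prog} (hP : P.Tame) {c : Config}
    (hc : ∀ i < 7, c.mem i = m i) : ∀ d ∈ P.run c, (∀ i < 7, d.mem i = m i) ∧
      d.time ≤ c.time + P.cost m := by
  induction P generalizing c with
  | assign a e =>
    intro d hd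
    simp only [run, List.mem_singleton] at hd
    subst hd
    refine ⟨fun i hi => ?_, le_rfl⟩
    have : i ≠ a.addr c.mem := by have := hP c.mem; omega
    simp [Function.update_of_ne this, hc i hi]
  | gate =>
    intro d hd
    simp only [run, List.mem_singleton] at hd
    subst hd
    exact ⟨hc, le_rfl⟩
  | measure q a =>
    intro d hd
    simp only [run, List.mem_map] at hd
    obtain ⟨v, -, rfl⟩ := hd
    refine ⟨fun i hi => ?_, le_rfl⟩
    have : i ≠ a.addr c.mem := by have := hP c.mem; omega
    simp [Function.update_of_ne this, hc i hi]
  | emit =>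
    intro d hd
    simp only [run, List.mem_singleton] at hd
    subst hd
    exact ⟨hc, le_rfl⟩
  | seq P Q ihP ihQ =>
    intro d hd
    simp only [run, List.mem_flatMap] at hd
    obtain ⟨d', hd', hd⟩ := hd
    obtain ⟨h1, h2⟩ := ihP hP.1 hc d' hd'
    obtain ⟨h3, h4⟩ := ihQ hP.2 h1 d hd
    exact ⟨h3, by simp only [cost]; omega⟩
  | ite e₁ e₂ P Q ihP ihQ =>
    intro d hd
    simp only [run] at hd
    split_ifs at hd
    · obtain ⟨h1, h2⟩ := ihP hP.1 (c := c.tick 1) hc d hd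
      exact ⟨h1, by simp only [cost, Config.tick] at h2 ⊢; omega⟩
    · obtain ⟨h1, h2⟩ := ihQ hP.2 (c := c.tick 1) hc d hd
      exact ⟨h1, by simp only [cost, Config.tick] at h2 ⊢; omega⟩
  | loop e P ih =>
    have key (k : ℕ) : ∀ d ∈ (fun L : List Config =>
        L.flatMap fun d => P.run (d.tick 1))^[k] [c.tick 1],
        (∀ i < 7, d.mem i = m i) ∧ d.time ≤ c.time + 1 + k * (1 + P.cost m) := by
      induction k with
      | zero =>
        intro d hd
        simp only [Function.iterate_zero, id, List.mem_singleton] at hd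
        subst hd
        exact ⟨hc, by simp [Config.tick]⟩
      | succ k ihk =>
        intro d hd
        rw [Function.iterate_succ_apply', List.mem_flatMap] at hd
        obtain ⟨d', hd', hd⟩ := hd
        obtain ⟨h1, h2⟩ := ihk d' hd'
        obtain ⟨h3, h4⟩ := ih hP.2 (c := d'.tick 1) h1 d hd
        refine ⟨h3, ?_⟩
        simp only [Config.tick] at h4
        rw [Nat.succ_mul]
        omega
    intro d hd
    obtain ⟨h1, h2⟩ := key _ d hd
    refine ⟨h1, ?_⟩
    rw [hP.1 c.mem m hc] at h2
    simp only [cost]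
    omega

end Prog

/-! ### Sampling by filters -/

/-- The contents of a fixed cell. -/
def Expr.var (i : ℕ) : Expr := .cell (.nat i)

@[simp] lemma Expr.val_var (m : ℕ → ℝ) (i : ℕ) : (Expr.var i).val m = m i := by
  simp [Expr.var, Expr.val]

@[simp] lemma Expr.val_nat (m : ℕ → ℝ) (i : ℕ) : (Expr.nat i).val m = i := rfl

@[simp] lemma Expr.val_add (m : ℕ → ℝ) (a b : Expr) : (a.add b).val m = a.val m + b.val m := rfl

@[simp] lemma Expr.val_sub (m : ℕ → ℝ) (a b : Expr) : (a.sub b).val m = a.val m - b.val m := rfl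

@[simp] lemma Expr.val_mul (m : ℕ → ℝ) (a b : Expr) : (a.mul b).val m = a.val m * b.val m := rfl

@[simp] lemma Expr.val_div (m : ℕ → ℝ) (a b : Expr) : (a.div b).val m = a.val m / b.val m := rfl

@[simp] lemma Expr.val_exp (m : ℕ → ℝ) (a : Expr) : a.exp.val m = Real.exp (a.val m) := rfl

@[simp] lemma Expr.val_log (m : ℕ → ℝ) (a : Expr) : a.log.val m = Real.log (a.val m) := rfl

@[simp] lemma Expr.val_arccos (m : ℕ → ℝ) (a : Expr) :
    a.arccos.val m = Real.arccos (a.val m) := rfl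

@[simp] lemma Expr.val_pi (m : ℕ → ℝ) : Expr.pi.val m = Real.pi := rfl

@[simp] lemma Expr.addr_nat (m : ℕ → ℝ) (i : ℕ) : (Expr.nat i).addr m = i := by
  simp [Expr.addr]

/-- The cells `7` and `9` hold the number `k` of the present sample and the number `t` of the
samples found so far, the cells `8`, `10` and `11` are scratch cells, and the other cells have
the values `M`. -/
structure Frame (M : ℕ → ℝ) (k t : ℕ) (out : List ℕ) (c : Config) : Prop where
  mem : ∀ i, i < 7 ∨ 12 ≤ i → c.mem i = M i
  idx : c.mem 7 = k
  cnt : c.mem 9 = t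
  out : c.out = out

lemma Frame.of_eq {M : ℕ → ℝ} {k t : ℕ} {out : List ℕ} {c d : Config} (h : Frame M k t out c)
    (h1 : ∀ i, i ≠ 8 → i ≠ 10 → i ≠ 11 → d.mem i = c.mem i) (h2 : d.out = c.out) :
    Frame M k t out d where
  mem i hi := by rw [h1 i (by omega) (by omega) (by omega), h.mem i hi]
  idx := by rw [h1 7 (by omega) (by omega) (by omega), h.idx]
  cnt := by rw [h1 9 (by omega) (by omega) (by omega), h.cnt]
  out := by rw [h2, h.out]

/-- Applied to a sample of weight `a`, the program `F` gives a sample of weight `h` with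
probability `p`. It reports failure in cell `8`. -/
def IsFilter (F : Prog) (M : ℕ → ℝ) (s : Fin n → ZMod N) (a h : ℤ → ℝ) (p : ℝ) : Prop :=
  ∀ (k t : ℕ) (out : List ℕ) (x : Fin n → ZMod N) (S : Finset ℕ) (ξ : ℕ → Block → ℂ) (w : ℝ)
    (c : Config) (V : Config → ℝ) (A B : ℝ), k ∈ S → Frame M k t out c →
    IsProduct S (Function.update ξ k (superpose (ray s x) a)) w c.amp →
    (∀ d, Frame M k t out d → d.mem 8 = 0 →
      IsProduct S (Function.update ξ k (superpose (ray s x) h)) w d.amp → A ≤ V d) →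
    (∀ d η u, Frame M k t out d → d.mem 8 = 1 → HasSum (fun β => ‖η β‖ ^ 2) u →
      IsProduct S (Function.update ξ k η) w d.amp → B * u ≤ V d) →
    A + B * (1 - p) ≤ F.branchSum V c

/-- Treat one sample. -/
def sampleStep (F : Prog) : Prog :=
  .seq
    (.ite (.var 4) (.var 9) (.assign (.nat 8) (.nat 0))
      (.seq F
        (.ite (.var 8) (.nat 0)
          (.seq (.emit (.var 7)) (.assign (.nat 9) (.add (.var 9) (.nat 1))))
          (.assign (.nat 8) (.nat 0)))))
    (.assign (.nat 7) (.add (.var 7) (.nat 1)))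

/-- Filter the samples one by one, until as many as wanted are found. -/
def sampler (F : Prog) : Prog := .loop (.var 3) (sampleStep F)

/-- A lower bound for the probability of at least `t` successes in `m` independent trials of
success probability `p`. -/
def chance (p : ℝ) (m t : ℕ) : ℝ := if t = 0 then 1 else 1 - 2 ^ t * (1 - p / 2) ^ m

lemma chance_le_one {p : ℝ} (hp : p ≤ 1) (m t : ℕ) : chance p m t ≤ 1 := by
  unfold chance
  split_ifs
  · exact le_rfl
  · have : 0 ≤ (2 : ℝ) ^ t * (1 - p / 2) ^ m :=
      mul_nonneg (by positivity) (pow_nonneg (by linarith) _)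
    linarith

/-- The bound `2^t (1 - p/2)^m` comes from the moment `E[2^{-X}] = (1 - p/2)^m` of the number `X` of
successes. It satisfies the recursion for one more trial exactly, as `p 2^t + (1 - p) 2^{t+1} =
2^{t+1} (1 - p/2)`; the inequality is only due to the value `1` at `t = 0`. -/
lemma chance_succ {p : ℝ} (h0 : 0 ≤ p) (h1 : p ≤ 1) (m t : ℕ) :
    chance p (m + 1) (t + 1) ≤ p * chance p m t + (1 - p) * chance p m (t + 1) := by
  have h : 1 - 2 ^ t * (1 - p / 2) ^ m ≤ chance p m t := by
    unfold chance
    split_ifs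
    · have : 0 ≤ (2 : ℝ) ^ t * (1 - p / 2) ^ m :=
        mul_nonneg (by positivity) (pow_nonneg (by linarith) _)
      linarith
    · exact le_rfl
  calc chance p (m + 1) (t + 1)
      = p * (1 - 2 ^ t * (1 - p / 2) ^ m) + (1 - p) * chance p m (t + 1) := by
        simp only [chance, Nat.succ_ne_zero, if_false]
        ring
    _ ≤ _ := by gcongr

/-- Success probability of the samples that a filter provides. -/
theorem IsFilter.sampler {F : Prog} {M : ℕ → ℝ} {s : Fin n → ZMod N} {f g h : ℤ → ℝ} {p : ℝ}
    [NeZero N] {ℓ ℓ' : ℕ} (hF : IsFilter F M s (amplitude f) h p) (hp0 : 0 ≤ p) (hp1 : p ≤ 1)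
    (hf : HasSum (fun j => amplitude f j ^ 2) 1)
    (hh : h = fun j => √p * amplitude g j) (hM3 : M 3 = ℓ) (hM4 : M 4 = ℓ')
    (X : ℕ → Fin n → ZMod N) (O : Solver n N ℓ') {π : ℝ} (hπ : 0 ≤ π)
    (hO : ∀ x, π ≤ O.prob s (state g s x)) {c : Config} (hc : Frame M 0 0 [] c)
    (hψ : IsProduct (Finset.range ℓ) (fun k => superpose (ray s (X k)) (amplitude f)) 1 c.amp) :
    π * chance p ℓ ℓ' ≤ (EDCP.sampler F).branchSum (O.branchProb s) c := by
  -- Invariant with `m` samples left: emitted blocks have weight `g`, blocks from `k` on are still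
  -- untouched, and discarded blocks belong to the rest, whose squared norm `w` is the probability
  -- of the branch.
  have key (m : ℕ) : ∀ (k : ℕ) (out : List ℕ) (w : ℝ) (c : Config), k + m = ℓ →
      Frame M k out.length out c → out.Nodup → (∀ i ∈ out, i < k) → out.length ≤ ℓ' →
      IsProduct (out.toFinset ∪ Finset.Ico k ℓ) (fun i => superpose (ray s (X i))
        (if i ∈ out then amplitude g else amplitude f)) w c.amp →
      w * (π * chance p m (ℓ' - out.length)) ≤
        ((sampleStep F).iter^[m] (O.branchProb s)) c := by
    induction m with
    | zero =>
      intro k out w c hk hc hnd _ hlen hψ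
      rw [Function.iterate_zero, id]
      have hw := hψ.nonneg
      rcases hlen.eq_or_lt with h | h
      · obtain rfl : k = ℓ := by omega
        have ho := hc.out
        subst ho
        rw [O.branchProb_eq s c h hnd X g w]
        · gcongr
          calc π * chance p 0 (ℓ' - c.out.length) ≤ π * 1 := by
                gcongr; exact chance_le_one hp1 _ _
            _ ≤ _ := by rw [mul_one]; exact hO _
        · simp only [Finset.Ico_self, Finset.union_empty] at hψ
          refine hψ.congr fun i hi => ?_
          rw [if_pos (by simpa using hi)]
      -- No trial is left but samples are missing: the claimed bound is not positive, so it holds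
      -- although the output is void.
      · have : chance p 0 (ℓ' - out.length) ≤ 0 := by
          rw [chance, if_neg (by omega)]
          have : (1 : ℝ) ≤ 2 ^ (ℓ' - out.length) := one_le_pow₀ (by norm_num)
          simpa using this
        refine le_trans ?_ (O.branchProb_nonneg _ _)
        exact mul_nonpos_of_nonneg_of_nonpos hw (mul_nonpos_of_nonneg_of_nonpos hπ this)
    | succ m ih =>
      intro k out w c hk hc hnd hlt hlen hψ
      have hw := hψ.nonneg
      have hkout : k ∉ out := fun h => (hlt k h).false
      have hkS : k ∈ out.toFinset ∪ Finset.Ico k ℓ := by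
        simp only [Finset.mem_union, Finset.mem_Ico]; omega
      have hS : (out.toFinset ∪ Finset.Ico k ℓ).erase k =
          out.toFinset ∪ Finset.Ico (k + 1) ℓ := by
        ext i
        simp only [Finset.mem_erase, Finset.mem_union, List.mem_toFinset, Finset.mem_Ico]
        constructor
        · rintro ⟨h1, h2 | h2⟩
          · exact Or.inl h2
          · right; omega
        · rintro (h | h)
          · exact ⟨fun h' => hkout (h' ▸ h), Or.inl h⟩
          · exact ⟨by omega, by right; omega⟩
      rw [Function.iterate_succ_apply', Prog.iter]
      generalize (sampleStep F).iter^[m] (O.branchProb s) = W at ih ⊢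
      rw [sampleStep, Prog.branchSum_seq]
      have hcm : ∀ d : Config, Frame M k out.length out d → d.mem 4 = ℓ' ∧ d.mem 9 = out.length :=
        fun d hd => ⟨by rw [hd.mem 4 (by omega), hM4], hd.cnt⟩
      obtain ⟨h4, h9⟩ := hcm c hc
      -- the next iteration after a sample was discarded
      have hdis (d : Config) (η : Block → ℂ) (u : ℝ) (hd : Frame M k out.length out d)
          (hu : HasSum (fun β => ‖η β‖ ^ 2) u)
          (hη : IsProduct (out.toFinset ∪ Finset.Ico k ℓ) (Function.update (fun i =>
            superpose (ray s (X i)) (if i ∈ out then amplitude g else amplitude f)) k η) w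
            d.amp) :
          w * (π * chance p m (ℓ' - out.length)) * u ≤
            (Prog.assign (.nat 8) (.nat 0)).branchSum
              ((Prog.assign (.nat 7) (.add (.var 7) (.nat 1))).branchSum
                W) d := by
        rw [Prog.branchSum_assign, Prog.branchSum_assign]
        have := ih (k + 1) out (w * u) { d with
            mem := Function.update (Function.update d.mem 8 0) 7 (d.mem 7 + 1)
            time := d.time + 1 + 1 } (by omega)
          ⟨fun i hi => ?_, ?_, ?_, ?_⟩ hnd (fun i hi => (hlt i hi).trans (by omega)) hlen ?_
        · refine le_of_eq_of_le (by ring) (this.trans_eq ?_)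
          simp [Config.tick]
        · rw [← hd.mem i hi]
          simp [Function.update_of_ne (show i ≠ 7 by omega),
            Function.update_of_ne (show i ≠ 8 by omega)]
        · simp [hd.idx]
        · simp [hd.cnt]
        · exact hd.out
        · rw [← hS]
          refine (hη.discard hkS (t := u) (by simpa using hu)).congr fun i hi => ?_
          rw [Function.update_of_ne (Finset.ne_of_mem_erase hi)]
      rcases hlen.eq_or_lt with h | h
      -- Enough samples are found; the present one is dropped unfiltered, with its full squared norm
      -- `1`.
      · rw [Prog.branchSum_ite_pos _ _ _ _ _ _ (by
          simp only [Expr.val_var, Config.tick, h4, h9, h, le_refl])]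
        have := hdis ((c.tick 1).tick 1) _ 1 (hc.of_eq (fun _ _ _ _ => rfl) rfl)
          (hasSum_superpose (ray_injective s (X k)) hf)
          (by
            refine hψ.congr fun i _ => ?_
            by_cases hik : i = k
            · subst hik; simp [hkout]
            · simp [Function.update_of_ne hik])
        rw [h, Nat.sub_self] at this ⊢
        simpa [chance] using this
      · rw [Prog.branchSum_ite_neg _ _ _ _ _ _ (by
          simp only [Expr.val_var, Config.tick, h4, h9]
          exact_mod_cast not_le.2 h), Prog.branchSum_seq]
        obtain ⟨t, ht⟩ : ∃ t, ℓ' - out.length = t + 1 := ⟨ℓ' - out.length - 1, by omega⟩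
        have hmain := hF k out.length out (X k) (out.toFinset ∪ Finset.Ico k ℓ) (fun i =>
            superpose (ray s (X i)) (if i ∈ out then amplitude g else amplitude f)) w
          ((c.tick 1).tick 1) ((Prog.ite (.var 8) (.nat 0)
            (.seq (.emit (.var 7)) (.assign (.nat 9) (.add (.var 9) (.nat 1))))
            (.assign (.nat 8) (.nat 0))).branchSum
            ((Prog.assign (.nat 7) (.add (.var 7) (.nat 1))).branchSum
              W))
          -- The values after success and after failure. The first contains `p` because `h` has
          -- squared norm `p`; on failure the squared norm is supplied by `IsFilter`.
          (w * p * (π * chance p m t)) (w * (π * chance p m (ℓ' - out.length)))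
          hkS (hc.of_eq (fun _ _ _ _ => rfl) rfl) (by
            refine hψ.congr fun i _ => ?_
            by_cases hik : i = k
            · subst hik; simp [hkout]
            · simp [Function.update_of_ne hik]) ?_ ?_
        · refine le_trans ?_ hmain
          rw [ht]
          have := mul_le_mul_of_nonneg_left (chance_succ hp0 hp1 m t) (mul_nonneg hw hπ)
          refine (le_of_eq_of_le (by ring) this).trans_eq (by ring)
        · intro d hd hd8 hη
          rw [Prog.branchSum_ite_pos _ _ _ _ _ _ (by simp [hd8]), Prog.branchSum_seq,
            Prog.branchSum_emit, Prog.branchSum_assign, Prog.branchSum_assign]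
          have := ih (k + 1) (out ++ [k]) (w * p) { d with
            mem := Function.update (Function.update d.mem 9 (d.mem 9 + 1)) 7 (d.mem 7 + 1)
            out := out ++ [k]
            time := d.time + 1 + 1 + 1 + 1 } (by omega)
            ⟨fun i hi => ?_, ?_, ?_, ?_⟩ ?_ ?_ ?_ ?_
          · refine le_of_eq_of_le ?_ (this.trans_eq ?_)
            · congr 3
              simp only [List.length_append, List.length_singleton]
              omega
            · simp [Config.tick, Expr.addr, hd.idx, hd.out]
          · rw [← hd.mem i hi]
            simp [Function.update_of_ne (show i ≠ 7 by omega),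
              Function.update_of_ne (show i ≠ 9 by omega)]
          · simp [hd.idx]
          · simp [hd.cnt]
          · rfl
          · exact hnd.append (by simp) (by simpa using hkout)
          · intro i hi
            simp only [List.mem_append, List.mem_singleton] at hi
            rcases hi with hi | hi
            · have := hlt i hi; omega
            · omega
          · simp only [List.length_append, List.length_singleton]; omega
          -- The factor `√p` moves from the block to the rest. This leaves a normalized sample of
          -- weight `g` and turns `w` into `w * p`.
          · rw [hh, superpose_smul] at hη
            have := hη.rescale hkS
            rw [Complex.norm_real, Real.norm_eq_abs, sq_abs, Real.sq_sqrt hp0] at this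
            have hS' : (out ++ [k]).toFinset ∪ Finset.Ico (k + 1) ℓ =
                out.toFinset ∪ Finset.Ico k ℓ := by
              ext i
              simp only [Finset.mem_union, List.mem_toFinset, List.mem_append, Finset.mem_Ico,
                List.mem_singleton]
              constructor
              · rintro ((h | h) | h)
                · exact Or.inl h
                · right; omega
                · right; omega
              · rintro (h | h)
                · exact Or.inl (Or.inl h)
                · rcases h.1.eq_or_lt with h' | h'
                  · exact Or.inl (Or.inr h'.symm)
                  · right; omega
            rw [hS']
            refine this.congr fun i _ => ?_
            by_cases hik : i = k
            · subst hik; simp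
            · simp [hik]
        · intro d η u hd hd8 hu hη
          rw [Prog.branchSum_ite_neg _ _ _ _ _ _ (by simp [hd8])]
          exact hdis (d.tick 1) η u (hd.of_eq (fun _ _ _ _ => rfl) rfl) hu hη
  rw [EDCP.sampler, Prog.branchSum_loop]
  have h3 : (Expr.var 3).addr c.mem = ℓ := by
    simp [Expr.addr, hc.mem 3 (by omega), hM3]
  rw [h3]
  have := key ℓ 0 [] 1 (c.tick 1) (by omega) (hc.of_eq (fun _ _ _ _ => rfl) rfl) (by simp)
    (by simp) (by simp) (by
      simp only [List.toFinset_nil, Finset.empty_union, List.not_mem_nil, if_false,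
        ← Finset.range_eq_Ico]
      exact hψ)
  simpa using this

/-! ### Bounds along the branches of a filter -/

/-- The qubit that stores binary digit `i` of `|j|` in the present sample, where `i` is the
contents of cell `a`. -/
def bitQubit (a : ℕ) : QubitExpr := ⟨.var 7, .nat 0, .add (.var a) (.nat 1)⟩

/-- The number of binary digits that are treated. -/
def digits : Expr :=
  .add (.var 0) (.add (.var 3) (.add (.nat 1) (.mul (.nat 4) (.log (.add (.nat 1) (.var 5))))))

/-- The data of a sample in a product state of which the other parts are left alone. -/
structure Setting (n N : ℕ) where
  (M : ℕ → ℝ) (k t : ℕ) (out : List ℕ) (s x : Fin n → ZMod N) (S : Finset ℕ)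
  (ξ : ℕ → Block → ℂ) (w A B ν : ℝ) (mem : k ∈ S)

/-- On success so far, the sample has weight `h` and `V` is at least `A` plus `B` times the
expected squared norm of the future failures; on failure, `V` is at least `B` times the squared
norm. -/
structure Setting.Bound (D : Setting n N) (h : ℤ → ℝ) (pre : (ℕ → ℝ) → Prop)
    (V : Config → ℝ) : Prop where
  good : ∀ c, Frame D.M D.k D.t D.out c → c.mem 8 = 0 → pre c.mem →
    IsProduct D.S (Function.update D.ξ D.k (superpose (ray D.s D.x) h)) D.w c.amp →
    D.A + D.B * (∑' j, h j ^ 2 - D.ν) ≤ V c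
  bad : ∀ c η u, Frame D.M D.k D.t D.out c → c.mem 8 = 1 → pre c.mem →
    HasSum (fun β => ‖η β‖ ^ 2) u →
    IsProduct D.S (Function.update D.ξ D.k η) D.w c.amp → D.B * u ≤ V c

/-- A scratch cell is assigned. -/
lemma Setting.Bound.assign {D : Setting n N} {h : ℤ → ℝ} {pre pre' : (ℕ → ℝ) → Prop}
    {V : Config → ℝ} (hV : D.Bound h pre' V) (a : ℕ) (ha : a = 10 ∨ a = 11) (e : Expr)
    (hp : ∀ c, Frame D.M D.k D.t D.out c → pre c.mem →
      pre' (Function.update c.mem a (e.val c.mem))) :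
    D.Bound h pre ((Prog.assign (.nat a) e).branchSum V) where
  good c hc h8 hpre hψ := by
    rw [Prog.branchSum_assign, Expr.addr_nat]
    refine hV.good _ (hc.of_eq (fun i _ _ _ => ?_) rfl) ?_ (hp c hc hpre) hψ
    · exact Function.update_of_ne (by omega) _ _
    · simpa [Function.update_of_ne (show 8 ≠ a by omega)] using h8
  bad c η u hc h8 hpre hu hψ := by
    rw [Prog.branchSum_assign, Expr.addr_nat]
    refine hV.bad _ η u (hc.of_eq (fun i _ _ _ => ?_) rfl) ?_ (hp c hc hpre) hu hψ
    · exact Function.update_of_ne (by omega) _ _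
    · simpa [Function.update_of_ne (show 8 ≠ a by omega)] using h8

lemma Setting.Bound.tick {D : Setting n N} {h : ℤ → ℝ} {pre : (ℕ → ℝ) → Prop}
    {V : Config → ℝ} (hV : D.Bound h pre V) (t : ℕ) : D.Bound h pre fun c => V (c.tick t) where
  good c hc h8 hpre hψ :=
    hV.good (c.tick t) (hc.of_eq (fun _ _ _ _ => rfl) rfl) h8 hpre hψ
  bad c η u hc h8 hpre hu hψ :=
    hV.bad (c.tick t) η u (hc.of_eq (fun _ _ _ _ => rfl) rfl) h8 hpre hu hψ

/-- A loop of which iteration `i` multiplies the weight by `a i`. -/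
lemma Setting.Bound.iterate {D : Setting n N} {P : Prog} {pre : ℕ → (ℕ → ℝ) → Prop}
    {a : ℕ → ℤ → ℝ} (ha : ∀ i z, |a i z| ≤ 1)
    (hP : ∀ i h V, Summable (fun z => h z ^ 2) → D.Bound (fun z => h z * a i z) (pre (i + 1)) V →
      D.Bound h (pre i) (P.branchSum V)) (m : ℕ) :
    ∀ i h V, Summable (fun z => h z ^ 2) →
      D.Bound (fun z => h z * ∏ l ∈ Finset.range m, a (i + l) z) (pre (i + m)) V →
      D.Bound h (pre i) (P.iter^[m] V) := by
  induction m with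
  | zero => intro i h V _ hV; simpa using hV
  | succ m ih =>
    intro i h V hh hV
    rw [Function.iterate_succ_apply']
    refine (hP i h _ hh (ih (i + 1) _ V ?_ ?_)).tick 1
    · refine Summable.of_nonneg_of_le (fun _ => by positivity) (fun z => ?_) hh
      have : a i z ^ 2 ≤ 1 := (sq_le_one_iff_abs_le_one _).2 (ha i z)
      rw [mul_pow]
      nlinarith [sq_nonneg (h z)]
    · have e1 : i + 1 + m = i + (m + 1) := by ring
      rw [e1]
      convert hV using 2 with z
      rw [Finset.prod_range_succ', mul_assoc]
      congr 1
      rw [mul_comm, add_zero]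
      congr 1
      exact Finset.prod_congr rfl fun l _ => by rw [add_right_comm, add_assoc]

lemma Setting.Bound.loop {D : Setting n N} {P : Prog} {pre : ℕ → (ℕ → ℝ) → Prop}
    {a : ℕ → ℤ → ℝ} (ha : ∀ i z, |a i z| ≤ 1)
    (hP : ∀ i h V, Summable (fun z => h z ^ 2) → D.Bound (fun z => h z * a i z) (pre (i + 1)) V →
      D.Bound h (pre i) (P.branchSum V)) (e : Expr) (m : ℕ)
    (he : ∀ c, Frame D.M D.k D.t D.out c → e.addr c.mem = m) {h : ℤ → ℝ} {V : Config → ℝ}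
    (hh : Summable (fun z => h z ^ 2))
    (hV : D.Bound (fun z => h z * ∏ l ∈ Finset.range m, a l z) (pre m) V) :
    D.Bound h (pre 0) ((Prog.loop e P).branchSum V) := by
  have := (Setting.Bound.iterate ha hP m 0 h V hh (by simpa using hV)).tick 1
  refine ⟨fun c hc h8 hpre hψ => ?_, fun c η u hc h8 hpre hu hψ => ?_⟩
  · rw [Prog.branchSum_loop, he c hc]
    exact this.good c hc h8 hpre hψ
  · rw [Prog.branchSum_loop, he c hc]
    exact this.bad c η u hc h8 hpre hu hψ

/-! ### The Gaussian filter -/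

/-- The qubit that is used for the measurements. -/
def ancilla : QubitExpr := ⟨.var 7, .add (.var 1) (.nat 1), .nat 0⟩

/-- The factor that is due to the digits `i` and `j`. -/
def dampFactor : Expr :=
  .exp (.sub (.nat 0) (.mul .pi (.mul (.exp (.mul (.add (.var 10) (.var 11)) (.log (.nat 2))))
    (.sub (.div (.nat 1) (.mul (.var 6) (.var 6))) (.div (.nat 1) (.mul (.var 5) (.var 5)))))))

/-- Damp the amplitudes for which the digits `i` and `j` are both `1`. -/
def dampPair : Prog :=
  .ite (.var 8) (.nat 0)
    (.seq (.gate (.nat 0) (.arccos dampFactor) (.nat 0) (.nat 0) ancilla [bitQubit 10, bitQubit 11])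
      (.measure ancilla (.nat 8)))
    (.assign (.nat 10) (.var 10))

/-- Each row runs through all digits `j`, including `j = i`, where the two controls coincide. All
ordered pairs are wanted, since the square of a sum has them all. -/
def dampRow : Prog :=
  .seq
    (.seq (.assign (.nat 11) (.nat 0))
      (.loop digits (.seq dampPair (.assign (.nat 11) (.add (.var 11) (.nat 1))))))
    (.assign (.nat 10) (.add (.var 10) (.nat 1)))

/-- Multiply the amplitude of `|j⟩` by `exp(-π j² (1/r₂² - 1/r₁²))`. -/
def gaussianFilter : Prog :=
  .seq (.assign (.nat 8) (.nat 0)) (.seq (.assign (.nat 10) (.nat 0)) (.loop digits dampRow))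

/-- The ancilla starts at `0`, so outcome `0` leaves the factor `cos θ` and a clean ancilla, ready
for the next rotation. -/
lemma projectLocal_rotate_false {e : ℤ → Block} (he : Function.Injective e) {q : ℕ × ℕ}
    (hq : ∀ j, e j q = false) {ctrl : List (ℕ × ℕ)} (hc : q ∉ ctrl) (h : ℤ → ℝ) (θ : ℝ)
    {b : ℤ → Prop} [DecidablePred b] (hb : ∀ j, (∀ p ∈ ctrl, e j p = true) ↔ b j) :
    projectLocal q false (applyLocal (gateEntry 0 θ 0 0) q ctrl (superpose e h)) =
      superpose e fun j => h j * if b j then Real.cos θ else 1 := by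
  have hu (β : Block) : superpose e h (Function.update β q true) = 0 :=
    superpose_eq_zero fun j hj => by simpa [hq j] using congrFun hj q
  refine eq_superpose he (fun j => ?_) (fun β hβ => ?_)
  · have : Function.update (e j) q false = e j := by rw [← hq j, Function.update_eq_self]
    simp only [projectLocal, hq, applyLocal, if_true, hc, not_false_eq_true, true_and, hu, this, hb,
      superpose_apply he]
    split_ifs <;> simp [gateEntry, mul_comm]
  · by_cases hβq : β q = false
    · have : Function.update β q false = β := by rw [← hβq, Function.update_eq_self]
      simp [projectLocal, applyLocal, hu, this, superpose_eq_zero hβ]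
    · simp [projectLocal, hβq]

/-- On outcome `1` the basis states are those of the ray with the ancilla set. They are still
distinct, and only the squared norm matters, since the sample will be discarded. -/
lemma projectLocal_rotate_true {e : ℤ → Block} (he : Function.Injective e) {q : ℕ × ℕ}
    (hq : ∀ j, e j q = false) {ctrl : List (ℕ × ℕ)} (hc : q ∉ ctrl) (h : ℤ → ℝ) (θ : ℝ)
    {b : ℤ → Prop} [DecidablePred b] (hb : ∀ j, (∀ p ∈ ctrl, e j p = true) ↔ b j) {u : ℝ}
    (hu : HasSum (fun j => (h j * if b j then Real.sin θ else 0) ^ 2) u) :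
    HasSum (fun β => ‖projectLocal q true
      (applyLocal (gateEntry 0 θ 0 0) q ctrl (superpose e h)) β‖ ^ 2) u := by
  have hinj : Function.Injective fun j => Function.update (e j) q true := by
    intro j j' hj
    refine he (funext fun i => ?_)
    by_cases hi : i = q
    · rw [hi, hq, hq]
    · simpa [hi] using congrFun hj i
  have : projectLocal q true (applyLocal (gateEntry 0 θ 0 0) q ctrl (superpose e h)) =
      superpose (fun j => Function.update (e j) q true)
        (fun j => h j * if b j then Real.sin θ else 0) := by
    have hz (β : Block) (hβ : β q = true) : superpose e h β = 0 :=
      superpose_eq_zero fun j hj => by rw [← hj, hq] at hβ; simp at hβ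
    refine eq_superpose hinj (fun j => ?_) (fun β hβ => ?_)
    · have h1 : Function.update (e j) q false = e j := by rw [← hq j, Function.update_eq_self]
      have h2 : (∀ p ∈ ctrl, Function.update (e j) q true p = true) ↔
          b j := by
        rw [← hb]
        exact forall₂_congr fun p hp => by rw [Function.update_of_ne (ne_of_mem_of_not_mem hp hc)]
      simp only [projectLocal, applyLocal, h2, hc, not_false_eq_true, true_and,
        Function.update_self, Function.update_idem, h1, superpose_apply he, if_true]
      rw [hz _ (by simp)]
      split_ifs <;> simp [gateEntry, mul_comm]
    · by_cases hβq : β q = true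
      · have h1 : superpose e h (Function.update β q false) = 0 := by
          refine superpose_eq_zero fun j hj => hβ j ?_
          simp only [hj, Function.update_idem, ← hβq, Function.update_eq_self]
        have h2 : Function.update β q true = β := by rw [← hβq, Function.update_eq_self]
        simp [projectLocal, applyLocal, h1, h2, hz β hβq]
      · simp [projectLocal, hβq]
  rw [this]
  exact hasSum_superpose hinj hu

/-- The factor `exp(-π 2^{i+j} δ)`, if the digits `i` and `j` of `|z|` are `1`. -/
def pairFactor (δ : ℝ) (i j : ℕ) (z : ℤ) : ℝ :=
  if z.natAbs.testBit i = true ∧ z.natAbs.testBit j = true then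
    Real.exp (-(Real.pi * (2 ^ (i + j) * δ))) else 1

lemma abs_pairFactor_le {δ : ℝ} (hδ : 0 ≤ δ) (i j : ℕ) (z : ℤ) : |pairFactor δ i j z| ≤ 1 := by
  unfold pairFactor
  split_ifs
  · rw [Real.abs_exp, Real.exp_le_one_iff, neg_nonpos]
    positivity
  · simp

/-- With `θ = arccos γ`, success multiplies by `γ` and failure takes the factor `sin² θ = 1 - γ²`.
The squared norm of the failure is thus exactly the drop of `∑ h²`, and the bound telescopes along
the loop. -/
lemma dampPair_bound {D : Setting n N} (hM1 : D.M 1 = n) {δ : ℝ} (hδ : 0 ≤ δ)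
    (hMδ : 1 / (D.M 6 * D.M 6) - 1 / (D.M 5 * D.M 5) = δ) {i j : ℕ} {h : ℤ → ℝ}
    {V : Config → ℝ} (hh : Summable (fun z => h z ^ 2))
    (hV : D.Bound (fun z => h z * pairFactor δ i j z) (fun m => m 10 = i ∧ m 11 = j) V) :
    D.Bound h (fun m => m 10 = i ∧ m 11 = j) (dampPair.branchSum V) where
  good c hc h8 hpre hψ := by
    have he := ray_injective D.s D.x
    have hq : ∀ z, ray D.s D.x z (n + 1, 0) = false := fun z => by simp [ray, encodeSample]
    have hctrl : (n + 1, 0) ∉ [(0, i + 1), (0, j + 1)] := by simp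
    have hb (z : ℤ) : (∀ p ∈ [(0, i + 1), (0, j + 1)], ray D.s D.x z p = true) ↔
        (z.natAbs.testBit i = true ∧ z.natAbs.testBit j = true) := by
      simp [ray, encodeSample]
    set γ := Real.exp (-(Real.pi * (2 ^ (i + j) * δ))) with hγ
    have hγ0 : 0 < γ := Real.exp_pos _
    have hγ1 : γ ≤ 1 := by
      rw [hγ, Real.exp_le_one_iff, neg_nonpos]
      positivity
    have hd : dampFactor.val (c.tick 1).mem = γ := by
      simp only [dampFactor, Config.tick, Expr.val_exp, Expr.val_sub, Expr.val_nat, Expr.val_mul,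
        Expr.val_pi, Expr.val_add, Expr.val_log, Expr.val_div, Expr.val_var, hpre.1, hpre.2,
        hc.mem 5 (by omega), hc.mem 6 (by omega), Nat.cast_zero, Nat.cast_one, hMδ, Nat.cast_ofNat,
        zero_sub, hγ]
      rw [mul_comm (_ + _) (Real.log 2), Real.exp_mul, Real.exp_log two_pos, ← Nat.cast_add,
        Real.rpow_natCast]
    have ha : ancilla.addr (c.tick 1).mem = (D.k, n + 1, 0) := by
      simp [ancilla, QubitExpr.addr, Expr.addr, Config.tick, hc.idx, hc.mem 1 (by omega), hM1,
        Nat.floor_add_one]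
    have hbit : [bitQubit 10, bitQubit 11].map (QubitExpr.addr (c.tick 1).mem) =
        [(0, i + 1), (0, j + 1)].map fun p => (D.k, p) := by
      simp [bitQubit, QubitExpr.addr, Expr.addr, Config.tick, hc.idx, hpre.1, hpre.2,
        Nat.floor_add_one]
    rw [dampPair, Prog.branchSum_ite_pos _ _ _ _ _ _ (by simp [h8]),
      Prog.branchSum_seq, Prog.branchSum_gate, Prog.branchSum_measure]
    rw [hbit]
    change _ ≤ V { (c.tick 1).tick 3 |>.tick 1 with
          mem := Function.update c.mem ((Expr.nat 8).addr c.mem) 0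
          amp := project (ancilla.addr (c.tick 1).mem) false _ } +
        V { (c.tick 1).tick 3 |>.tick 1 with
          mem := Function.update c.mem ((Expr.nat 8).addr c.mem) 1
          amp := project (ancilla.addr (c.tick 1).mem) true _ }
    rw [ha, Expr.addr_nat, Expr.val_arccos, hd, Expr.val_nat, Nat.cast_zero]
    have hψ' := IsProduct.applyGate D.mem hψ (gateEntry 0 (Real.arccos γ) 0 0) (n + 1, 0)
      [(0, i + 1), (0, j + 1)]
    have hs : HasSum (fun z => (h z * if z.natAbs.testBit i = true ∧
        z.natAbs.testBit j = true then Real.sin (Real.arccos γ) else 0) ^ 2)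
        (∑' z, h z ^ 2 - ∑' z, (h z * pairFactor δ i j z) ^ 2) := by
      have hs' : Summable fun z => (h z * pairFactor δ i j z) ^ 2 := by
        refine Summable.of_nonneg_of_le (fun _ => by positivity) (fun z => ?_) hh
        have := (sq_le_one_iff_abs_le_one _).2 (abs_pairFactor_le hδ i j z)
        rw [mul_pow]
        nlinarith [sq_nonneg (h z)]
      refine hasSum_of_eq (hh.hasSum.sub hs'.hasSum) fun z => ?_
      simp only [pairFactor, ← hγ]
      split_ifs
      · rw [mul_pow, Real.sin_arccos, Real.sq_sqrt (by nlinarith)]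
        ring
      · ring
    refine le_trans (le_of_eq ?_) (add_le_add
      (hV.good _ (hc.of_eq (fun l h _ _ => ?_) rfl) ?_ ?_ ?_)
      (hV.bad _ _ _ (hc.of_eq (fun l h _ _ => ?_) rfl) ?_ ?_
        (projectLocal_rotate_true he hq hctrl h _ hb hs) (hψ'.project D.mem _ _)))
    · ring
    · exact Function.update_of_ne h _ _
    · simp
    · simpa using hpre
    · have := hψ'.project D.mem (n + 1, 0) false
      rw [projectLocal_rotate_false he hq hctrl h _ hb] at this
      simp only [Real.cos_arccos (by linarith) hγ1] at this
      exact this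
    · exact Function.update_of_ne h _ _
    · simp
    · simpa using hpre
  -- After a failure the step assigns cell `10` to itself, so the failed sample stays as it is until
  -- the loops end.
  bad c η u hc h8 hpre hu hψ := by
    rw [dampPair, Prog.branchSum_ite_neg _ _ _ _ _ _ (by simp [h8]),
      Prog.branchSum_assign]
    refine hV.bad _ η u (hc.of_eq (fun l _ h _ => ?_) rfl) ?_ ?_ hu hψ
    · exact Function.update_of_ne (by simpa using h) _ _
    · simpa [Config.tick] using h8
    · simpa [Config.tick] using hpre

/-- The factor of the Gaussian filter, for digits below `L`. -/
def damping (δ : ℝ) (L : ℕ) (z : ℤ) : ℝ :=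
  Real.exp (-(Real.pi * δ * ((z.natAbs % 2 ^ L : ℕ) : ℝ) ^ 2))

lemma sum_testBit (m L : ℕ) :
    ∑ i ∈ Finset.range L, (if m.testBit i = true then (2 : ℝ) ^ i else 0) =
      ((m % 2 ^ L : ℕ) : ℝ) := by
  induction L with
  | zero => simp [Nat.mod_one]
  | succ L ih =>
    rw [Finset.sum_range_succ, ih, Nat.mod_pow_succ, ← Nat.toNat_testBit]
    cases m.testBit L <;> simp

/-- If `b_i` are the digits, `(∑ b_i 2^i)² = ∑ b_i b_j 2^{i+j}` over all ordered pairs; digits from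
`L` on are ignored, hence the remainder modulo `2^L`. -/
lemma prod_pairFactor (δ : ℝ) (L : ℕ) (z : ℤ) :
    ∏ i ∈ Finset.range L, ∏ j ∈ Finset.range L, pairFactor δ i j z = damping δ L z := by
  have : ∀ i j, pairFactor δ i j z = Real.exp (-(Real.pi * δ *
      ((if z.natAbs.testBit i = true then (2 : ℝ) ^ i else 0) *
        (if z.natAbs.testBit j = true then (2 : ℝ) ^ j else 0)))) := by
    intro i j
    unfold pairFactor
    cases z.natAbs.testBit i <;> cases z.natAbs.testBit j <;> simp [pow_add]
    ring
  simp only [this, ← Real.exp_sum, damping, ← sum_testBit]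
  simp only [Finset.sum_neg_distrib, ← Finset.mul_sum, ← Finset.sum_mul, sq]

lemma gaussianFilter_isFilter {M : ℕ → ℝ} (hM1 : M 1 = n) {δ : ℝ} (hδ : 0 ≤ δ)
    (hMδ : 1 / (M 6 * M 6) - 1 / (M 5 * M 5) = δ) (s : Fin n → ZMod N) {a : ℤ → ℝ}
    (ha : HasSum (fun z => a z ^ 2) 1) {p : ℝ}
    (hp : HasSum (fun z => (a z * damping δ (digits.addr M) z) ^ 2) p) :
    IsFilter gaussianFilter M s a (fun z => a z * damping δ (digits.addr M) z) p := by
  intro k t out x S ξ w c V A B hk hc hψ hA hB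
  -- With `ν = p` the expected norm of future failures is `0` at the end and `1 - p` at the start,
  -- where `∑ a² = 1`.
  let D : Setting n N := ⟨M, k, t, out, s, x, S, ξ, w, A, B, p, hk⟩
  have hL : ∀ c, Frame D.M D.k D.t D.out c → digits.addr c.mem = digits.addr M := by
    intro c hc
    simp [digits, Expr.addr, hc.mem 0 (by omega), hc.mem 3 (by omega), hc.mem 5 (by omega), D]
  generalize digits.addr M = L at *
  have hfin : D.Bound (fun z => a z * damping δ L z) (fun m => m 10 = (L : ℕ)) V := by
    refine ⟨fun d hd h8 _ hψ => ?_, fun d η u hd h8 _ hu hψ => hB d η u hd h8 hu hψ⟩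
    rw [hp.tsum_eq, sub_self, mul_zero, add_zero]
    exact hA d hd h8 hψ
  have hrow : ∀ i h V, Summable (fun z => h z ^ 2) →
      D.Bound (fun z => h z * ∏ j ∈ Finset.range L, pairFactor δ i j z)
        (fun m => m 10 = ((i + 1 : ℕ) : ℝ)) V →
      D.Bound h (fun m => m 10 = i) (dampRow.branchSum V) := by
    intro i h V hh hV
    have h1 : D.Bound (fun z => h z * ∏ j ∈ Finset.range L, pairFactor δ i j z)
        (fun m => m 10 = (i : ℕ) ∧ m 11 = (L : ℕ))
        ((Prog.assign (.nat 10) (.add (.var 10) (.nat 1))).branchSum V) :=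
      hV.assign 10 (by simp) _ fun c hc hpre => by simp [hpre.1]
    have h2 := Setting.Bound.loop (D := D) (P := .seq dampPair
        (.assign (.nat 11) (.add (.var 11) (.nat 1)))) (a := pairFactor δ i)
      (pre := fun j m => m 10 = (i : ℕ) ∧ m 11 = (j : ℕ)) (fun j z => abs_pairFactor_le hδ i j z)
      (fun j h V hh hV => by
        have := dampPair_bound (D := D) hM1 hδ hMδ hh (hV.assign 11 (by simp)
          (.add (.var 11) (.nat 1)) (pre := fun m => m 10 = (i : ℕ) ∧ m 11 = (j : ℕ))
          fun c hc hpre => by simp [hpre.1, hpre.2])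
        simpa only [← Prog.branchSum_seq] using this) digits L hL hh h1
    have h3 := h2.assign 11 (by simp) (.nat 0) (pre := fun m => m 10 = (i : ℕ))
      fun c hc hpre => by simp [hpre]
    rw [← Prog.branchSum_seq, ← Prog.branchSum_seq] at h3
    exact h3
  have hloop := Setting.Bound.loop (D := D) (P := dampRow)
    (a := fun i z => ∏ j ∈ Finset.range L, pairFactor δ i j z)
    (pre := fun i m => m 10 = (i : ℕ)) (fun i z => by
      rw [Finset.abs_prod]
      exact Finset.prod_le_one (fun _ _ => abs_nonneg _) fun j _ => abs_pairFactor_le hδ i j z)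
    hrow digits L hL ha.summable (by simpa only [prod_pairFactor] using hfin)
  have h0 := hloop.assign 10 (by simp) (.nat 0) (pre := fun _ => True) fun c _ _ => by simp
  rw [gaussianFilter, Prog.branchSum_seq, Prog.branchSum_assign, Prog.branchSum_seq]
  have := h0.good { c.tick 1 with
      mem := Function.update c.mem ((Expr.nat 8).addr c.mem) ((Expr.nat 0).val c.mem) }
    (hc.of_eq (fun l h _ _ => Function.update_of_ne (by simpa using h) _ _) rfl)
    (by simp) trivial hψ
  rwa [ha.tsum_eq] at this

/-! ### The uniform filter -/

/-- The invariant `Q` of a loop bounds the sum over the branches. -/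
lemma Prog.le_iter {P : Prog} {C : ℝ} (m : ℕ) : ∀ {Q : ℕ → Config → Prop},
    (∀ i c t, Q i c → Q i (c.tick t)) →
    (∀ i < m, ∀ V : Config → ℝ, (∀ c, Q (i + 1) c → C ≤ V c) → ∀ c, Q i c → C ≤ P.branchSum V c) →
    ∀ V : Config → ℝ, (∀ c, Q m c → C ≤ V c) → ∀ c, Q 0 c → C ≤ (P.iter^[m] V) c := by
  induction m with
  | zero => intro Q _ _ V hV c hc; exact hV c hc
  | succ m ih =>
    intro Q ht hP V hV c hc
    rw [Function.iterate_succ_apply']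
    refine hP 0 (by omega) _ (fun d hd => ?_) _ (ht 0 c 1 hc)
    exact ih (Q := fun i => Q (i + 1)) (fun i => ht (i + 1))
      (fun i hi => hP (i + 1) (by omega)) V hV d hd

lemma Prog.le_loop {P : Prog} {C : ℝ} {m : ℕ} {Q : ℕ → Config → Prop}
    (ht : ∀ i c t, Q i c → Q i (c.tick t))
    (hP : ∀ i < m, ∀ V : Config → ℝ, (∀ c, Q (i + 1) c → C ≤ V c) → ∀ c, Q i c →
      C ≤ P.branchSum V c) {e : Expr} {V : Config → ℝ} (hV : ∀ c, Q m c → C ≤ V c) {c : Config}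
    (he : e.addr c.mem = m) (hc : Q 0 c) : C ≤ (Prog.loop e P).branchSum V c := by
  rw [Prog.branchSum_loop, he]
  exact Prog.le_iter m ht hP V hV _ (ht 0 c 1 hc)

/-- Carry qubit `e` of the present sample. -/
def carryQubit (e : Expr) : QubitExpr := ⟨.var 7, .add (.var 1) (.nat 1), e⟩

/-- The controlled negation of a qubit. -/
def notGate (q : QubitExpr) (ctrl : List QubitExpr) : Prog :=
  .gate (.nat 0) (.div .pi (.nat 2)) (.nat 0) .pi q ctrl

/-- The cell with digit `i` of the threshold, where `i` is the contents of cell `10`. -/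
def tableCell : Expr := .add (.nat 20) (.mul (.var 10) (.var 10))

/-- Add the majority of digit `i` of `j`, the negated digit `i` of the threshold, and the carry
qubit `i` to the carry qubit `i + 1`. -/
def carryStep : Prog :=
  .seq (notGate (carryQubit (.add (.var 10) (.nat 1))) [bitQubit 10, carryQubit (.var 10)])
    (.ite (.nat 1) (.cell tableCell) (.assign (.nat 11) (.nat 0))
      (.seq (notGate (carryQubit (.add (.var 10) (.nat 1))) [bitQubit 10])
        (notGate (carryQubit (.add (.var 10) (.nat 1))) [carryQubit (.var 10)])))

/-- Compute the carries, measure the last of them, and uncompute the carries. -/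
def uniformFilter : Prog :=
  .seq (.assign (.nat 10) (.nat 0))
    (.seq (.loop digits (.seq carryStep (.assign (.nat 10) (.add (.var 10) (.nat 1)))))
      (.seq (.measure (carryQubit (.var 10)) (.nat 8))
        (.loop digits (.seq (.assign (.nat 10) (.sub (.var 10) (.nat 1))) carryStep))))

/-- The controlled negation on the computational basis. -/
def flip (q : ℕ × ℕ) (ctrl : List (ℕ × ℕ)) (β : Block) : Block :=
  Function.update β q (β q ^^ ctrl.all β)

lemma flip_flip {q : ℕ × ℕ} {ctrl : List (ℕ × ℕ)} (hq : q ∉ ctrl) (β : Block) :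
    flip q ctrl (flip q ctrl β) = β := by
  have : ctrl.all (flip q ctrl β) = ctrl.all β := by
    rw [Bool.eq_iff_iff, List.all_eq_true, List.all_eq_true]
    refine forall₂_congr fun p hp => ?_
    rw [flip, Function.update_of_ne (ne_of_mem_of_not_mem hp hq)]
  rw [flip, this]
  simp [flip]

/-- At `θ = π/2` the diagonal vanishes, and the phase `ω = π` cancels the minus sign of the upper
right entry. -/
lemma applyLocal_not {q : ℕ × ℕ} {ctrl : List (ℕ × ℕ)} (hq : q ∉ ctrl) (η : Block → ℂ) :
    applyLocal (gateEntry 0 (Real.pi / 2) 0 Real.pi) q ctrl η = fun β => η (flip q ctrl β) := by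
  funext β
  have hπ : Complex.exp (Complex.I * Real.pi) = -1 := by
    rw [mul_comm]; exact Complex.exp_pi_mul_I
  by_cases h : ∀ p ∈ ctrl, β p = true
  · have h' : ctrl.all β = true := List.all_eq_true.2 h
    simp only [applyLocal, if_pos (show q ∉ ctrl ∧ ∀ p ∈ ctrl, β p = true from ⟨hq, h⟩), flip, h']
    cases hβ : β q <;> simp [gateEntry, hπ]
  · have h' : ctrl.all β = false := by
      rw [Bool.eq_false_iff, Ne, List.all_eq_true]; exact h
    simp only [applyLocal, if_neg (fun hc : q ∉ ctrl ∧ ∀ p ∈ ctrl, β p = true => h hc.2), flip,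
      h', Bool.xor_false, Function.update_eq_self]

/-- The state of the memory while the carries are computed. -/
structure CarryState (D : Setting n N) (v : ℝ) (i : ℕ) (e : ℤ → Block) (h : ℤ → ℝ)
    (c : Config) : Prop where
  frame : Frame D.M D.k D.t D.out c
  flag : c.mem 8 = v
  pos : c.mem 10 = i
  inj : Function.Injective e
  prod : IsProduct D.S (Function.update D.ξ D.k (superpose e h)) D.w c.amp

lemma CarryState.tick {D : Setting n N} {v : ℝ} {i : ℕ} {e : ℤ → Block} {h : ℤ → ℝ}
    {c : Config} (hc : CarryState D v i e h c) (t : ℕ) : CarryState D v i e h (c.tick t) :=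
  ⟨hc.frame.of_eq (fun _ _ _ _ => rfl) rfl, hc.flag, hc.pos, hc.inj, hc.prod⟩

/-- As `flip` is an involution, composing the coefficients with it amounts to relabelling the basis
states; the coefficients `h` do not change. -/
lemma CarryState.le_notGate {D : Setting n N} {v : ℝ} {i : ℕ} {e : ℤ → Block} {h : ℤ → ℝ}
    {C : ℝ} {V : Config → ℝ} {q : ℕ × ℕ} {ctrl : List (ℕ × ℕ)} (hq : q ∉ ctrl)
    (hV : ∀ c, CarryState D v i (fun j => flip q ctrl (e j)) h c → C ≤ V c)
    {qe : QubitExpr} {ce : List QubitExpr} {c : Config} (hc : CarryState D v i e h c)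
    (hqe : qe.addr c.mem = (D.k, q))
    (hce : ce.map (QubitExpr.addr c.mem) = ctrl.map fun p => (D.k, p)) :
    C ≤ (notGate qe ce).branchSum V c := by
  rw [notGate, Prog.branchSum_gate]
  refine hV _ ⟨hc.frame.of_eq (fun _ _ _ _ => rfl) rfl, hc.flag, hc.pos, ?_, ?_⟩
  · intro j j' hj
    exact hc.inj (by simpa [flip_flip hq] using congrArg (flip q ctrl) hj)
  · have hs : superpose (fun j => flip q ctrl (e j)) h = fun β => superpose e h (flip q ctrl β) := by
      funext β
      by_cases hβ : ∃ j, flip q ctrl (e j) = β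
      · obtain ⟨j, rfl⟩ := hβ
        rw [flip_flip hq, superpose_apply hc.inj]
        refine superpose_apply (e := fun j => flip q ctrl (e j)) (fun j j' hj => hc.inj ?_) h j
        simpa [flip_flip hq] using congrArg (flip q ctrl) hj
      · rw [superpose_eq_zero fun j hj => hβ ⟨j, hj⟩, superpose_eq_zero fun j hj => hβ ⟨j, ?_⟩]
        rw [hj, flip_flip hq]
    rw [hqe, hce, hs, ← applyLocal_not hq]
    simpa using IsProduct.applyGate D.mem hc.prod (gateEntry 0 (Real.pi / 2) 0 Real.pi) q ctrl

/-- One step of the comparison with a number that has digit `d`. -/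
def nextCarry (d b g : Bool) : Bool := (b && g) ^^ (!d && (b ^^ g))

/-- The majority of `b`, `g` and `!d` is `b ∧ g` if `d = 1` and `(b ∧ g) ⊕ b ⊕ g` if `d = 0`. The
threshold digit is classical, so it only decides whether the two singly controlled gates are
applied. -/
lemma CarryState.le_carryStep {D : Setting n N} {v : ℝ} {i : ℕ} {e : ℤ → Block} {h : ℤ → ℝ}
    {C : ℝ} {V : Config → ℝ} {d : Bool} (hM1 : D.M 1 = n)
    (hd : D.M (20 + i * i) = if d = true then 1 else 0)
    (hV : ∀ c, CarryState D v i (fun j => Function.update (e j) (n + 1, i + 1)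
      (e j (n + 1, i + 1) ^^ nextCarry d (e j (0, i + 1)) (e j (n + 1, i)))) h c → C ≤ V c)
    {c : Config} (hc : CarryState D v i e h c) : C ≤ carryStep.branchSum V c := by
  have hq1 : ∀ {e : ℤ → Block} {c : Config}, CarryState D v i e h c →
      (carryQubit (.add (.var 10) (.nat 1))).addr c.mem = (D.k, n + 1, i + 1) := by
    intro e c hc
    simp [carryQubit, QubitExpr.addr, Expr.addr, hc.frame.idx, hc.frame.mem 1 (by omega), hM1,
      hc.pos, Nat.floor_add_one]
  have hq0 : ∀ {e : ℤ → Block} {c : Config}, CarryState D v i e h c →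
      (carryQubit (.var 10)).addr c.mem = (D.k, n + 1, i) := by
    intro e c hc
    simp [carryQubit, QubitExpr.addr, Expr.addr, hc.frame.idx, hc.frame.mem 1 (by omega), hM1,
      hc.pos, Nat.floor_add_one]
  have hb : ∀ {e : ℤ → Block} {c : Config}, CarryState D v i e h c →
      (bitQubit 10).addr c.mem = (D.k, 0, i + 1) := by
    intro e c hc
    simp [bitQubit, QubitExpr.addr, Expr.addr, hc.frame.idx, hc.pos, Nat.floor_add_one]
  rw [carryStep, Prog.branchSum_seq]
  refine CarryState.le_notGate (q := (n + 1, i + 1)) (ctrl := [(0, i + 1), (n + 1, i)]) (by simp)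
    (fun c hc => ?_) hc (hq1 hc) (by simp [hb hc, hq0 hc])
  have ht : (Expr.cell tableCell).val c.mem = if d = true then 1 else 0 := by
    have : ⌊(20 : ℝ) + i * i⌋₊ = 20 + i * i := by
      exact_mod_cast Nat.floor_natCast (R := ℝ) (20 + i * i)
    simp [Expr.val, tableCell, hc.pos, this, hc.frame.mem (20 + i * i) (by omega), hd]
  cases d
  · rw [Prog.branchSum_ite_neg _ _ _ _ _ _ (by rw [ht]; simp), Prog.branchSum_seq]
    replace hc := hc.tick 1
    refine CarryState.le_notGate (q := (n + 1, i + 1)) (ctrl := [(0, i + 1)]) (by simp)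
      (fun c hc => ?_) hc (hq1 hc) (by simp [hb hc])
    refine CarryState.le_notGate (q := (n + 1, i + 1)) (ctrl := [(n + 1, i)]) (by simp)
      (fun c hc => ?_) hc (hq1 hc) (by simp [hq0 hc])
    refine hV c ?_
    convert hc using 2 with j
    simp [flip, nextCarry]
  · rw [Prog.branchSum_ite_pos _ _ _ _ _ _ (by rw [ht]; simp), Prog.branchSum_assign]
    have hflip : (fun j => flip (n + 1, i + 1) [(0, i + 1), (n + 1, i)] (e j)) =
        fun j => Function.update (e j) (n + 1, i + 1)
          (e j (n + 1, i + 1) ^^ nextCarry true (e j (0, i + 1)) (e j (n + 1, i))) := by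
      funext j
      simp [flip, nextCarry]
    rw [hflip] at hc
    refine hV _ ⟨hc.frame.of_eq (fun l _ _ hl => ?_) rfl, ?_, ?_, hc.inj, hc.prod⟩
    · exact Function.update_of_ne (by simpa using hl) _ _
    · simpa [Config.tick] using hc.flag
    · simpa [Config.tick] using hc.pos

/-- Whether `|z|` exceeds `m`, when only the digits below `i` are considered. -/
def carry (m : ℕ) (z : ℤ) (i : ℕ) : Bool := decide (m % 2 ^ i < z.natAbs % 2 ^ i)

/-- The new digits decide unless they agree, in which case the lower digits do; this is the majority
of the digit of `|z|`, the negated digit of `m`, and the old carry. -/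
lemma carry_succ (m : ℕ) (z : ℤ) (i : ℕ) :
    carry m z (i + 1) = nextCarry (m.testBit i) (z.natAbs.testBit i) (carry m z i) := by
  have h1 : m % 2 ^ i < 2 ^ i := Nat.mod_lt _ (by positivity)
  have h2 : z.natAbs % 2 ^ i < 2 ^ i := Nat.mod_lt _ (by positivity)
  rw [carry, Nat.mod_pow_succ, Nat.mod_pow_succ, ← Nat.toNat_testBit, ← Nat.toNat_testBit, carry]
  cases m.testBit i <;> cases z.natAbs.testBit i <;>
    simp [nextCarry] <;> omega

/-- The basis states with the carries up to `i`. -/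
def carryRay (m : ℕ) (s x : Fin n → ZMod N) (i : ℕ) (z : ℤ) : Block := fun q =>
  if q.1 = n + 1 ∧ q.2 ≤ i then carry m z q.2 else ray s x z q

lemma ray_carry (s x : Fin n → ZMod N) (z : ℤ) (l : ℕ) : ray s x z (n + 1, l) = false := by
  simp [ray, encodeSample]

lemma carryRay_zero (m : ℕ) (s x : Fin n → ZMod N) : carryRay m s x 0 = ray s x := by
  funext z q
  unfold carryRay
  split_ifs with h
  · obtain ⟨a, b⟩ := q
    obtain ⟨rfl, hb⟩ := h
    obtain rfl : b = 0 := by simpa using hb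
    rw [ray_carry]
    simp [carry, Nat.mod_one]
  · rfl

lemma carryRay_injective (m : ℕ) (s x : Fin n → ZMod N) (i : ℕ) :
    Function.Injective (carryRay m s x i) := by
  intro z z' h
  refine ray_injective s x (funext fun q => ?_)
  by_cases hq : q.1 = n + 1
  · obtain ⟨a, b⟩ := q
    obtain rfl : a = n + 1 := hq
    rw [ray_carry, ray_carry]
  · simpa [carryRay, hq] using congrFun h q

lemma update_carryRay (m : ℕ) (s x : Fin n → ZMod N) (i : ℕ) (z : ℤ) :
    Function.update (carryRay m s x i z) (n + 1, i + 1) (carryRay m s x i z (n + 1, i + 1) ^^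
      nextCarry (m.testBit i) (carryRay m s x i z (0, i + 1)) (carryRay m s x i z (n + 1, i))) =
      carryRay m s x (i + 1) z := by
  have hv : (carryRay m s x i z (n + 1, i + 1) ^^
      nextCarry (m.testBit i) (carryRay m s x i z (0, i + 1)) (carryRay m s x i z (n + 1, i))) =
      carry m z (i + 1) := by
    rw [carry_succ]
    simp [carryRay, ray_carry]
    rfl
  rw [hv]
  funext q
  by_cases hq : q = (n + 1, i + 1)
  · subst hq; simp [carryRay]
  · rw [Function.update_of_ne hq]
    simp only [carryRay]
    have : (q.1 = n + 1 ∧ q.2 ≤ i) ↔ (q.1 = n + 1 ∧ q.2 ≤ i + 1) := by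
      obtain ⟨a, b⟩ := q
      simp only [Prod.mk.injEq] at hq ⊢
      omega
    simp only [this]

/-- The step adds modulo two a function of qubits that it leaves alone. Repeated while carry `i` is
present, it erases carry `i + 1`. -/
lemma update_carryRay_succ (m : ℕ) (s x : Fin n → ZMod N) (i : ℕ) (z : ℤ) :
    Function.update (carryRay m s x (i + 1) z) (n + 1, i + 1)
      (carryRay m s x (i + 1) z (n + 1, i + 1) ^^
      nextCarry (m.testBit i) (carryRay m s x (i + 1) z (0, i + 1))
        (carryRay m s x (i + 1) z (n + 1, i))) = carryRay m s x i z := by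
  have hv : (carryRay m s x (i + 1) z (n + 1, i + 1) ^^
      nextCarry (m.testBit i) (carryRay m s x (i + 1) z (0, i + 1))
        (carryRay m s x (i + 1) z (n + 1, i))) = false := by
    have : ray s x z (0, i + 1) = z.natAbs.testBit i := rfl
    simp [carryRay, carry_succ, this]
  rw [hv]
  funext q
  by_cases hq : q = (n + 1, i + 1)
  · subst hq; simp [carryRay, ray_carry]
  · rw [Function.update_of_ne hq]
    simp only [carryRay]
    have : (q.1 = n + 1 ∧ q.2 ≤ i + 1) ↔ (q.1 = n + 1 ∧ q.2 ≤ i) := by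
      obtain ⟨a, b⟩ := q
      simp only [Prod.mk.injEq] at hq ⊢
      omega
    simp only [this]

lemma projectLocal_superpose {e : ℤ → Block} (he : Function.Injective e) (h : ℤ → ℝ)
    (q : ℕ × ℕ) (v : Bool) : projectLocal q v (superpose e h) =
      superpose e fun z => if e z q = v then h z else 0 := by
  refine eq_superpose he (fun j => ?_) (fun β hβ => ?_)
  · simp only [projectLocal, superpose_apply he]
    split_ifs <;> simp
  · simp [projectLocal, superpose_eq_zero hβ]

/-- The measurement changes the coefficients but not the labels, so the carries can be erased from
the top down after either outcome. The loop decrements first because erasing carry `l + 1` is the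
step at digit `l`. -/
lemma CarryState.le_uncompute {D : Setting n N} {v : ℝ} {h : ℤ → ℝ} {C : ℝ} {V : Config → ℝ}
    {m L : ℕ} (hM1 : D.M 1 = n)
    (hM : ∀ i < L, D.M (20 + i * i) = if m.testBit i = true then 1 else 0)
    (hL : ∀ c, Frame D.M D.k D.t D.out c → digits.addr c.mem = L)
    (hV : ∀ c, CarryState D v 0 (ray D.s D.x) h c → C ≤ V c) {c : Config}
    (hc : CarryState D v L (carryRay m D.s D.x L) h c) :
    C ≤ (Prog.loop digits
      (.seq (.assign (.nat 10) (.sub (.var 10) (.nat 1))) carryStep)).branchSum V c := by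
  refine Prog.le_loop (m := L)
    (Q := fun i => CarryState D v (L - i) (carryRay m D.s D.x (L - i)) h)
    (fun _ _ _ h => h.tick _) (fun i hi V hV c hc => ?_) (fun c hc => hV c ?_) (hL c hc.frame) hc
  · obtain ⟨l, hl⟩ : ∃ l, L - i = l + 1 := ⟨L - i - 1, by omega⟩
    have hl' : L - (i + 1) = l := by omega
    rw [hl] at hc
    rw [hl'] at hV
    rw [Prog.branchSum_seq, Prog.branchSum_assign]
    refine CarryState.le_carryStep (v := v) (i := l) (e := carryRay m D.s D.x (l + 1)) hM1 (hM l (by omega))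
      (fun c hc => hV c ?_) ⟨hc.frame.of_eq (fun l _ hl _ => ?_) rfl, ?_, ?_, hc.inj, hc.prod⟩
    · simpa only [update_carryRay_succ] using hc
    · exact Function.update_of_ne (by simpa using hl) _ _
    · simpa using hc.flag
    · simp [hc.pos]
  · simpa [carryRay_zero] using hc

lemma uniformFilter_isFilter {M : ℕ → ℝ} (hM1 : M 1 = n) {m : ℕ}
    (hM : ∀ i < digits.addr M, M (20 + i * i) = if m.testBit i = true then 1 else 0)
    (s : Fin n → ZMod N) {a : ℤ → ℝ} (ha : HasSum (fun z => a z ^ 2) 1) {p : ℝ}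
    (hp : HasSum (fun z => (if carry m z (digits.addr M) = false then a z else 0) ^ 2) p) :
    IsFilter uniformFilter M s a (fun z => if carry m z (digits.addr M) = false then a z else 0)
      p := by
  intro k t out x S ξ w c V A B hk hc hψ hA hB
  let D : Setting n N := ⟨M, k, t, out, s, x, S, ξ, w, A, B, p, hk⟩
  have hL : ∀ c, Frame D.M D.k D.t D.out c → digits.addr c.mem = digits.addr M := by
    intro c hc
    simp [digits, Expr.addr, hc.mem 0 (by omega), hc.mem 3 (by omega), hc.mem 5 (by omega), D]
  generalize digits.addr M = L at *
  rw [uniformFilter, Prog.branchSum_seq, Prog.branchSum_assign, Prog.branchSum_seq]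
  -- Cell `8` still holds an arbitrary value here; it becomes meaningful only with the measurement.
  refine Prog.le_loop (m := L) (Q := fun i => CarryState D (c.mem 8) i (carryRay m D.s D.x i) a)
    (fun _ _ _ h => h.tick _) (fun i hi V hV c hc => ?_) (fun d hd => ?_)
    (hL _ (hc.of_eq (fun l _ hl _ => ?_) rfl)) ⟨hc.of_eq (fun l _ hl _ => ?_) rfl, ?_, ?_, ?_, ?_⟩
  · rw [Prog.branchSum_seq]
    refine CarryState.le_carryStep (D := D) hM1 (hM i hi) (fun c hc => ?_) hc
    simp only [update_carryRay] at hc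
    rw [Prog.branchSum_assign]
    refine hV _ ⟨hc.frame.of_eq (fun l _ hl _ => ?_) rfl, ?_, ?_, hc.inj, hc.prod⟩
    · exact Function.update_of_ne (by simpa using hl) _ _
    · simpa using hc.flag
    · simp [hc.pos]
  · have hq : (carryQubit (.var 10)).addr d.mem = (D.k, n + 1, L) := by
      simp [carryQubit, QubitExpr.addr, Expr.addr, hd.frame.idx, hd.frame.mem 1 (by omega), hM1, D,
        hd.pos, Nat.floor_add_one]
    have hcr (z : ℤ) : carryRay m D.s D.x L z (n + 1, L) = carry m z L := by simp [carryRay]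
    have hpr (v : Bool) := hd.prod.project D.mem (n + 1, L) v
    simp only [projectLocal_superpose hd.inj, hcr] at hpr
    rw [Prog.branchSum_seq, Prog.branchSum_measure, Expr.addr_nat, hq]
    -- The two outcomes split the support of `a`, so the squared norm of the failure is the
    -- complement of `p`.
    have hfail : HasSum (fun z => (if carry m z L = true then a z else 0) ^ 2) (1 - p) := by
      refine hasSum_of_eq (ha.sub hp) fun z => ?_
      cases carry m z L <;> simp
    refine add_le_add (CarryState.le_uncompute (D := D) (v := 0) hM1 hM hL (fun c hc => ?_)
      ⟨hd.frame.of_eq (fun l hl _ _ => ?_) rfl, ?_, ?_, hd.inj, hpr false⟩)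
      (CarryState.le_uncompute (D := D) (v := 1) hM1 hM hL (fun c hc => ?_)
      ⟨hd.frame.of_eq (fun l hl _ _ => ?_) rfl, ?_, ?_, hd.inj, hpr true⟩)
    · exact hA c hc.frame hc.flag hc.prod
    · exact Function.update_of_ne hl _ _
    · simp
    · simpa using hd.pos
    · exact hB c _ _ hc.frame hc.flag (hasSum_superpose hc.inj hfail) hc.prod
    · exact Function.update_of_ne hl _ _
    · simp
    · simpa using hd.pos
  · exact Function.update_of_ne (by simpa using hl) _ _
  · exact Function.update_of_ne (by simpa using hl) _ _
  · simp
  · simp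
  · exact carryRay_injective _ _ _ _
  · rw [carryRay_zero]; exact hψ

/-! ### The binary digits of the threshold -/

/-- Write the binary digits of `M₂ - 1` to memory. -/
def storeDigits : Prog :=
  .seq (.assign (.nat 11) (.sub (.var 6) (.nat 1)))
    (.seq (.loop digits (.assign (.nat 10) (.add (.var 10) (.nat 1))))
      (.loop digits
        (.seq (.assign (.nat 10) (.sub (.var 10) (.nat 1)))
          (.ite (.exp (.mul (.var 10) (.log (.nat 2)))) (.var 11)
            (.seq (.assign (.nat 11) (.sub (.var 11) (.exp (.mul (.var 10) (.log (.nat 2))))))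
              (.assign tableCell (.nat 1)))
            (.assign tableCell (.nat 0))))))

/-- The state of the memory while the digits of `m` are stored, from digit `i` upwards. -/
structure DigitState (c₀ : Config) (m L i r : ℕ) (c : Config) : Prop where
  mem : ∀ l < 10, c.mem l = c₀.mem l
  out : c.out = c₀.out
  amp : c.amp = c₀.amp
  pos : c.mem 10 = i
  rem : c.mem 11 = r
  table : ∀ l, i ≤ l → l < L → c.mem (20 + l * l) = if m.testBit l = true then 1 else 0

lemma tableCell_addr {m : ℕ → ℝ} {i : ℕ} (h : m 10 = i) : tableCell.addr m = 20 + i * i := by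
  have : ⌊(20 : ℝ) + i * i⌋₊ = 20 + i * i := by
    exact_mod_cast Nat.floor_natCast (R := ℝ) (20 + i * i)
  simp [Expr.addr, tableCell, h, this]

/-- The digits are found greedily from the top: the remainder `m % 2^(l+1)` is at least `2^l`
exactly if digit `l` is `1`. Counting cell `10` up from `0` first makes it equal to the number of
digits. -/
lemma le_storeDigits {c₀ : Config} {m : ℕ} (h6 : c₀.mem 6 = ((m + 1 : ℕ) : ℝ))
    (h10 : c₀.mem 10 = 0) (hm : m < 2 ^ digits.addr c₀.mem) {C : ℝ} {V : Config → ℝ}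
    (hV : ∀ c, DigitState c₀ m (digits.addr c₀.mem) 0 0 c → C ≤ V c) :
    C ≤ storeDigits.branchSum V c₀ := by
  have hL : ∀ c : Config, (∀ l < 10, c.mem l = c₀.mem l) →
      digits.addr c.mem = digits.addr c₀.mem := by
    intro c hc
    simp [digits, Expr.addr, hc 0 (by omega), hc 3 (by omega), hc 5 (by omega)]
  generalize digits.addr c₀.mem = L at *
  have htick : ∀ {i r : ℕ} {c : Config} (t : ℕ), DigitState c₀ m L i r c →
      DigitState c₀ m L i r (c.tick t) := fun t h => ⟨h.mem, h.out, h.amp, h.pos, h.rem, h.table⟩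
  have hinit : ∀ l < 10, Function.update c₀.mem 11 (c₀.mem 6 - 1) l = c₀.mem l := fun l hl =>
    Function.update_of_ne (by omega) _ _
  rw [storeDigits, Prog.branchSum_seq, Prog.branchSum_assign, Prog.branchSum_seq]
  refine Prog.le_loop (m := L) (Q := fun i c => (∀ l < 10, c.mem l = c₀.mem l) ∧
      c.out = c₀.out ∧ c.amp = c₀.amp ∧ c.mem 10 = i ∧ c.mem 11 = m)
    (fun _ _ _ h => h) (fun i hi V hV c hc => ?_) (fun c hc => ?_) (hL _ ?_) ⟨?_, rfl, rfl, ?_, ?_⟩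
  · rw [Prog.branchSum_assign]
    refine hV _ ⟨fun l hl => ?_, hc.2.1, hc.2.2.1, ?_, ?_⟩
    · simpa [Function.update_of_ne (show l ≠ 10 by omega)] using hc.1 l hl
    · simp [hc.2.2.2.1]
    · simpa using hc.2.2.2.2
  · obtain ⟨h1, h2, h3, h4, h5⟩ := hc
    refine Prog.le_loop (m := L) (Q := fun i => DigitState c₀ m L (L - i) (m % 2 ^ (L - i)))
      (fun _ _ _ h => htick _ h) (fun i hi V hV c hc => ?_) (fun c hc => hV c ?_) (hL _ h1)
      ⟨h1, h2, h3, h4, ?_, fun l h h' => by omega⟩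
    · obtain ⟨l, hl⟩ : ∃ l, L - i = l + 1 := ⟨L - i - 1, by omega⟩
      have hl' : L - (i + 1) = l := by omega
      rw [hl] at hc
      rw [hl'] at hV
      have hpow : ∀ m : ℕ → ℝ, m 10 = l →
          (Expr.exp (.mul (.var 10) (.log (.nat 2)))).val m = (2 : ℝ) ^ l := by
        intro m hm
        simp only [Expr.val_exp, Expr.val_mul, Expr.val_var, Expr.val_log, Expr.val_nat, hm,
          Nat.cast_ofNat]
        rw [mul_comm, Real.exp_mul, Real.exp_log two_pos, Real.rpow_natCast]
      have hrem := hc.rem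
      rw [Nat.mod_pow_succ, ← Nat.toNat_testBit] at hrem
      have hlt : ((m % 2 ^ l : ℕ) : ℝ) < 2 ^ l := by
        exact_mod_cast Nat.mod_lt m (show 0 < 2 ^ l by positivity)
      rw [Prog.branchSum_seq, Prog.branchSum_assign]
      set c' : Config := { c.tick 1 with
        mem := Function.update c.mem ((Expr.nat 10).addr c.mem)
          (((Expr.var 10).sub (.nat 1)).val c.mem) } with hc'
      have h10 : c'.mem 10 = l := by simp [hc', hc.pos]
      have h11 : c'.mem 11 = ((m % 2 ^ l + 2 ^ l * (m.testBit l).toNat : ℕ) : ℝ) := by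
        simpa [hc'] using hrem
      have hne : ∀ l, l ≠ 10 → c'.mem l = c.mem l := fun l hl => by
        simp [hc', Function.update_of_ne hl]
      have htab : ∀ b : ℝ, (b = if m.testBit l = true then 1 else 0) → ∀ mem : ℕ → ℝ,
          (∀ j, 20 ≤ j → mem j = c.mem j) → ∀ j, l ≤ j → j < L →
          Function.update mem (20 + l * l) b (20 + j * j) =
            if m.testBit j = true then 1 else 0 := by
        intro b hb mem hmem j hj hjL
        rcases hj.eq_or_lt with rfl | hj
        · rw [Function.update_self, hb]
        · rw [Function.update_of_ne (by nlinarith), hmem _ (by omega), hc.table j hj hjL]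
      by_cases hbit : m.testBit l = true
      · rw [Prog.branchSum_ite_pos _ _ _ _ _ _ (by
          rw [hpow _ h10, Expr.val_var, h11, hbit]
          simp), Prog.branchSum_seq, Prog.branchSum_assign, Prog.branchSum_assign]
        have h10' : Function.update c'.mem 11 (c'.mem 11 - 2 ^ l) 10 = l := by simpa using h10
        have hp := hpow c'.mem h10
        refine hV _ ⟨fun j hj => ?_, hc.out, hc.amp, ?_, ?_, ?_⟩
        · simp only [Config.tick, Expr.addr_nat, Expr.val_sub, Expr.val_var, hp,
            tableCell_addr h10']
          rw [Function.update_of_ne (by omega), Function.update_of_ne (by omega),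
            hne j (by omega), hc.mem j hj]
        · simp only [Config.tick, Expr.addr_nat, Expr.val_sub, Expr.val_var, hp,
            tableCell_addr h10']
          rw [Function.update_of_ne (by omega), Function.update_of_ne (by omega), h10]
        · simp only [Config.tick, Expr.addr_nat, Expr.val_sub, Expr.val_var, hp,
            tableCell_addr h10']
          rw [Function.update_of_ne (by omega), Function.update_self, h11, hbit]
          simp
        · simp only [Config.tick, Expr.addr_nat, Expr.val_sub, Expr.val_var, hp,
            tableCell_addr h10']
          refine htab _ (by simp [hbit]) _ fun j hj => ?_
          rw [Function.update_of_ne (by omega), hne j (by omega)]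
      · have hbit' : m.testBit l = false := by simpa using hbit
        rw [Prog.branchSum_ite_neg _ _ _ _ _ _ (by
          rw [hpow _ h10, Expr.val_var, h11, hbit', not_le]
          simpa using hlt), Prog.branchSum_assign]
        refine hV _ ⟨fun j hj => ?_, hc.out, hc.amp, ?_, ?_, ?_⟩
        · simp only [Config.tick, tableCell_addr h10]
          rw [Function.update_of_ne (by omega), hne j (by omega), hc.mem j hj]
        · simp only [Config.tick, tableCell_addr h10]
          rw [Function.update_of_ne (by omega), h10]
        · simp only [Config.tick, tableCell_addr h10]
          rw [Function.update_of_ne (by omega), h11, hbit']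
          simp
        · simp only [Config.tick, tableCell_addr h10]
          exact htab _ (by simp [hbit]) _ fun j hj => hne j (by omega)
    · simpa [Nat.mod_one] using hc
    · rw [h5, Nat.sub_zero, Nat.mod_eq_of_lt hm]
  · simpa using hinit
  · simpa using hinit
  · simp [h10]
  · simp [h6]

/-! ### Distance of product states -/

lemma hasSum_mul_of_nonneg {Y Z : Type*} {f : Y → ℝ} {g : Z → ℝ} {a b : ℝ} (hf : HasSum f a)
    (hg : HasSum g b) (hf0 : ∀ y, 0 ≤ f y) (hg0 : ∀ z, 0 ≤ g z) :
    HasSum (fun x : Y × Z => f x.1 * g x.2) (a * b) :=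
  hf.mul hg (hf.summable.mul_of_nonneg hg.summable hf0 hg0)

lemma hasSum_pi_prod {Y : Type*} {ℓ : ℕ} {F : Fin ℓ → Y → ℝ} {a : Fin ℓ → ℝ}
    (h0 : ∀ k y, 0 ≤ F k y) (h : ∀ k, HasSum (F k) (a k)) :
    HasSum (fun y : Fin ℓ → Y => ∏ k, F k (y k)) (∏ k, a k) := by
  induction ℓ with
  | zero => simp
  | succ ℓ ih =>
    let e : Y × (Fin ℓ → Y) ≃ (Fin (ℓ + 1) → Y) := Fin.consEquiv fun _ => Y
    have h1 := ih (F := fun k => F k.succ) (a := fun k => a k.succ) (fun k => h0 k.succ) fun k => h k.succ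
    have h2 := hasSum_mul_of_nonneg (h 0) h1 (h0 0) fun y =>
      Finset.prod_nonneg fun k _ => h0 k.succ _
    rw [← e.hasSum_iff, Fin.prod_univ_succ]
    refine hasSum_of_eq h2 fun y => ?_
    simp only [Function.comp, Fin.prod_univ_succ]
    rfl

/-- The coefficients of the input as real numbers. -/
def realState {ℓ : ℕ} (f : ℤ → ℝ) (s : Fin n → ZMod N) (x : Fin ℓ → Fin n → ZMod N)
    (y : Samples n N ℓ) : ℝ :=
  ∏ k, if (y k).2 = x k + (y k).1 • s then amplitude f (y k).1 else 0

lemma state_eq {ℓ : ℕ} (f : ℤ → ℝ) (s : Fin n → ZMod N) (x : Fin ℓ → Fin n → ZMod N) :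
    state f s x = fun y => (realState f s x y : ℂ) := by
  funext y
  rw [state, realState, Complex.ofReal_prod]
  refine Finset.prod_congr rfl fun k _ => ?_
  split_ifs <;> simp

/-- Both states are tensor products supported on the same rays, so their overlap is the `ℓ`-th power
of the overlap of the weights. -/
lemma hasSum_realState_mul {ℓ : ℕ} {f g : ℤ → ℝ} (h0 : ∀ j, 0 ≤ amplitude f j * amplitude g j)
    {c : ℝ} (hc : HasSum (fun j => amplitude f j * amplitude g j) c) (s : Fin n → ZMod N)
    (x : Fin ℓ → Fin n → ZMod N) :
    HasSum (fun y => realState f s x y * realState g s x y) (c ^ ℓ) := by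
  have h1 (k : Fin ℓ) : HasSum (fun y : Sample n N => if y.2 = x k + y.1 • s then
      amplitude f y.1 * amplitude g y.1 else 0) c := by
    have hinj : Function.Injective fun j : ℤ => ((j, x k + j • s) : Sample n N) :=
      fun j j' h => congrArg Prod.fst h
    rw [← hinj.hasSum_iff]
    · refine hasSum_of_eq hc fun j => ?_
      simp
    · intro y hy
      rw [if_neg]
      exact fun h => hy ⟨y.1, Prod.ext rfl h.symm⟩
  have h2 := hasSum_pi_prod (fun k y => by split_ifs <;> simp [h0]) h1
  rw [Finset.prod_const, Finset.card_univ, Fintype.card_fin] at h2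
  refine hasSum_of_eq h2 fun y => ?_
  rw [realState, realState, ← Finset.prod_mul_distrib]
  refine Finset.prod_congr rfl fun k _ => ?_
  split_ifs <;> simp

lemma hasSum_amplitude {f : ℤ → ℝ} {F : ℝ} (hf : HasSum (fun j => f j ^ 2) F) (hF : 0 < F) :
    HasSum (fun j => amplitude f j ^ 2) 1 := by
  have := hf.mul_left F⁻¹
  rw [inv_mul_cancel₀ hF.ne'] at this
  refine hasSum_of_eq this fun j => ?_
  rw [amplitude, hf.tsum_eq, div_pow, Real.sq_sqrt hF.le]
  ring

lemma memℓp_ofReal {I : Type} {u : I → ℝ} {t : ℝ} (h : HasSum (fun i => u i ^ 2) t) :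
    Memℓp (fun i => (u i : ℂ)) 2 := by
  refine memℓp_gen ?_
  simpa using h.summable

lemma norm_toL2_sq {I : Type} {u : I → ℝ} {t : ℝ} (h : HasSum (fun i => u i ^ 2) t) :
    ‖toL2 fun i => (u i : ℂ)‖ ^ 2 = t := by
  have := lp.norm_rpow_eq_tsum (p := 2) (by simp) (toL2 fun i => (u i : ℂ))
  rw [toL2, dif_pos (memℓp_ofReal h)] at this ⊢
  simp only [ENNReal.toReal_ofNat, Real.rpow_ofNat] at this
  rw [this, ← h.tsum_eq]
  simp

lemma norm_toL2_sub_sq {I : Type} {u v : I → ℝ} {a b c : ℝ} (hu : HasSum (fun i => u i ^ 2) a)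
    (hv : HasSum (fun i => v i ^ 2) b) (huv : HasSum (fun i => u i * v i) c) :
    ‖(toL2 fun i => (u i : ℂ)) - toL2 fun i => (v i : ℂ)‖ ^ 2 = a + b - 2 * c := by
  have h : HasSum (fun i => (u i - v i) ^ 2) (a + b - 2 * c) :=
    hasSum_of_eq ((hu.add hv).sub (huv.mul_left 2)) fun i => by ring
  rw [← norm_toL2_sq h]
  congr 2
  rw [toL2, toL2, toL2, dif_pos (memℓp_ofReal hu), dif_pos (memℓp_ofReal hv),
    dif_pos (memℓp_ofReal h)]
  ext i
  exact (Complex.ofReal_sub _ _).symm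

section Operators

variable {E : Type*} [NormedAddCommGroup E] [InnerProductSpace ℂ E]

lemma norm_le_one_of_isPositive [CompleteSpace E] {T : E →L[ℂ] E} (h : T.IsPositive) (h' : (1 - T).IsPositive) :
    ‖T‖ ≤ 1 :=
  (CStarAlgebra.norm_le_one_iff_of_nonneg T
    ((ContinuousLinearMap.nonneg_iff_isPositive T).2 h)).2 h'

lemma reApplyInnerSelf_le {T : E →L[ℂ] E} (hT : ‖T‖ ≤ 1) {u : E} (hu : ‖u‖ = 1) :
    T.reApplyInnerSelf u ≤ 1 := by
  rw [ContinuousLinearMap.reApplyInnerSelf]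
  calc _ ≤ ‖inner ℂ (T u) u‖ := RCLike.re_le_norm _
    _ ≤ ‖T u‖ * ‖u‖ := norm_inner_le_norm _ _
    _ ≤ 1 := by simpa [hu] using T.le_of_opNorm_le hT u

/-- The difference of the quadratic forms is a sum of two terms, each linear in `u - v` and bounded
by its norm. -/
lemma reApplyInnerSelf_sub_le {T : E →L[ℂ] E} (hT : ‖T‖ ≤ 1) {u v : E} (hu : ‖u‖ = 1)
    (hv : ‖v‖ = 1) : T.reApplyInnerSelf v - T.reApplyInnerSelf u ≤ 2 * ‖u - v‖ := by
  have h : inner ℂ (T v) v - inner ℂ (T u) u =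
      -(inner ℂ (T v) (u - v) + inner ℂ (T (u - v)) u) := by
    simp only [map_sub, inner_sub_left, inner_sub_right]
    ring
  have h1 : ‖inner ℂ (T v) (u - v)‖ ≤ ‖u - v‖ := by
    calc _ ≤ ‖T v‖ * ‖u - v‖ := norm_inner_le_norm _ _
      _ ≤ 1 * ‖u - v‖ := by
        gcongr
        simpa [hv] using T.le_of_opNorm_le hT v
      _ = _ := one_mul _
  have h2 : ‖inner ℂ (T (u - v)) u‖ ≤ ‖u - v‖ := by
    calc _ ≤ ‖T (u - v)‖ * ‖u‖ := norm_inner_le_norm _ _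
      _ ≤ ‖u - v‖ := by simpa [hu] using T.le_of_opNorm_le hT (u - v)
  rw [ContinuousLinearMap.reApplyInnerSelf, ContinuousLinearMap.reApplyInnerSelf, ← map_sub, h]
  calc _ ≤ ‖-(inner ℂ (T v) (u - v) + inner ℂ (T (u - v)) u)‖ := RCLike.re_le_norm _
    _ ≤ ‖inner ℂ (T v) (u - v)‖ + ‖inner ℂ (T (u - v)) u‖ := by
      rw [norm_neg]; exact norm_add_le _ _
    _ ≤ _ := by linarith

end Operators

lemma Solver.norm_effect_le {ℓ : ℕ} (O : Solver n N ℓ) (s : Fin n → ZMod N) :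
    ‖O.effect s‖ ≤ 1 :=
  norm_le_one_of_isPositive (O.pos s) (by simpa using O.sum_le {s})

lemma norm_toL2_state {ℓ : ℕ} {f : ℤ → ℝ} (hf : HasSum (fun j => amplitude f j ^ 2) 1)
    (s : Fin n → ZMod N) (x : Fin ℓ → Fin n → ZMod N) : ‖toL2 (state f s x)‖ = 1 := by
  have h := hasSum_realState_mul (f := f) (g := f) (fun j => mul_self_nonneg _)
    (by simpa only [← sq] using hf) s x
  simp only [← sq, one_pow] at h
  have := norm_toL2_sq h
  rw [state_eq]
  exact (pow_eq_one_iff_of_nonneg (norm_nonneg _) two_ne_zero).1 this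

lemma Solver.prob_state_le_one {ℓ : ℕ} (O : Solver n N ℓ) {f : ℤ → ℝ}
    (hf : HasSum (fun j => amplitude f j ^ 2) 1)
    (s : Fin n → ZMod N) (x : Fin ℓ → Fin n → ZMod N) : O.prob s (state f s x) ≤ 1 :=
  reApplyInnerSelf_le (O.norm_effect_le s) (norm_toL2_state hf s x)

/-- A small change of the weight changes the success probability of a solver by little. -/
lemma Solver.prob_state_le {ℓ : ℕ} (O : Solver n N ℓ) {f g : ℤ → ℝ} {F G τ : ℝ}
    (h0 : ∀ j, 0 ≤ f j) (hfg : ∀ j, f j ≤ g j) (hf : HasSum (fun j => f j ^ 2) F)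
    (hg : HasSum (fun j => g j ^ 2) G) (hF : 1 ≤ F) (hτ : G - F ≤ τ)
    (s : Fin n → ZMod N) (x : Fin ℓ → Fin n → ZMod N) :
    O.prob s (state f s x) - 2 * √(2 * (ℓ * τ)) ≤ O.prob s (state g s x) := by
  have hFG : F ≤ G := hasSum_le (fun j => by gcongr; exacts [h0 j, hfg j]) hf hg
  have hG : 0 < G := by linarith
  have hf1 := hasSum_amplitude hf (by linarith)
  have hg1 := hasSum_amplitude hg hG
  have hf0 : ∀ j, 0 ≤ amplitude f j := fun j => div_nonneg (h0 j) (Real.sqrt_nonneg _)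
  have hg0 : ∀ j, 0 ≤ amplitude g j := fun j =>
    div_nonneg ((h0 j).trans (hfg j)) (Real.sqrt_nonneg _)
  have hs : Summable fun j => amplitude g j * amplitude f j := by
    refine Summable.of_nonneg_of_le (fun j => mul_nonneg (hg0 j) (hf0 j)) (fun j => ?_)
      (hf1.summable.add hg1.summable)
    nlinarith [sq_nonneg (amplitude f j - amplitude g j), sq_nonneg (amplitude f j),
      sq_nonneg (amplitude g j)]
  obtain ⟨c, hc⟩ := hs
  -- From `f ≤ g` the overlap is at least `F / √(F G) ≥ F / G`, and `F ≥ 1` turns the absolute error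
  -- `τ` into a relative one.
  have hc1 : 1 - τ ≤ c := by
    have h1 : F / (√G * √F) ≤ c := by
      refine hasSum_le (fun j => ?_) (hf.mul_right (√G * √F)⁻¹) hc
      rw [amplitude, amplitude, hf.tsum_eq, hg.tsum_eq, div_mul_div_comm, ← div_eq_mul_inv]
      gcongr
      nlinarith [h0 j, hfg j]
    have h2 : F / G ≤ F / (√G * √F) := by
      have hF' : 0 < √F := Real.sqrt_pos.2 (by linarith)
      have hG' : 0 < √G := Real.sqrt_pos.2 hG
      gcongr
      calc √G * √F ≤ √G * √G := by gcongr
        _ = G := Real.mul_self_sqrt hG.le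
    have h3 : 1 - τ ≤ F / G := by
      rw [le_div_iff₀ hG]
      nlinarith
    linarith
  have hc0 : 0 ≤ c := hc.nonneg fun j => mul_nonneg (hg0 j) (hf0 j)
  -- Bernoulli's inequality; the squared distance `2 - 2 c^ℓ` is then at most `2 ℓ τ`.
  have hcl : 1 - ℓ * τ ≤ c ^ ℓ := by
    have := one_add_mul_le_pow (show -2 ≤ c - 1 by linarith) ℓ
    have h2 : (ℓ : ℝ) * (1 - τ) ≤ ℓ * c := by gcongr
    rw [add_sub_cancel] at this
    linarith
  have e1 := hasSum_realState_mul (f := g) (g := g) (fun j => mul_self_nonneg _)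
    (by simpa only [← sq] using hg1) s x
  have e2 := hasSum_realState_mul (f := f) (g := f) (fun j => mul_self_nonneg _)
    (by simpa only [← sq] using hf1) s x
  have e3 := hasSum_realState_mul (fun j => mul_nonneg (hg0 j) (hf0 j)) hc s x
  simp only [← sq, one_pow] at e1 e2
  have hd : ‖toL2 (state g s x) - toL2 (state f s x)‖ ≤ √(2 * (ℓ * τ)) := by
    refine Real.le_sqrt_of_sq_le ?_
    rw [state_eq, state_eq, norm_toL2_sub_sq e1 e2 e3]
    linarith
  have := reApplyInnerSelf_sub_le (O.norm_effect_le s) (norm_toL2_state hg1 s x)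
    (norm_toL2_state hf1 s x)
  rw [Solver.prob, Solver.prob]
  linarith

/-! ### Gaussian sums -/

lemma exp_neg_le_inv_sq {x : ℝ} (hx : 0 < x) : Real.exp (-x) ≤ 2 / x ^ 2 := by
  have := Real.quadratic_le_exp_of_nonneg hx.le
  rw [Real.exp_neg, inv_eq_one_div, div_le_div_iff₀ (Real.exp_pos _) (by positivity)]
  nlinarith

lemma gaussian_sq (r : ℝ) (j : ℤ) :
    gaussian r j ^ 2 = Real.exp (-Real.pi * (2 / r ^ 2) * (j : ℝ) ^ 2) := by
  rw [gaussian, ← Real.exp_nat_mul]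
  congr 1
  push_cast
  ring

/-- Polynomial decay is enough, because the cutoff `2^L` is exponentially large. -/
lemma gaussian_sq_le {r : ℝ} (hr : 0 < r) {j : ℤ} (hj : j ≠ 0) :
    gaussian r j ^ 2 ≤ r ^ 4 / (j : ℝ) ^ 4 := by
  have hj' : 0 < (j : ℝ) ^ 2 := by positivity
  rw [gaussian_sq, show -Real.pi * (2 / r ^ 2) * (j : ℝ) ^ 2 =
    -(Real.pi * (2 / r ^ 2) * (j : ℝ) ^ 2) by ring]
  refine (exp_neg_le_inv_sq (by positivity)).trans ?_
  rw [div_le_div_iff₀ (by positivity) (by positivity)]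
  have h1 : (1 : ℝ) ≤ Real.pi ^ 2 := one_le_pow₀ (by linarith [Real.pi_gt_three])
  have h2 : r ^ 4 * (Real.pi * (2 / r ^ 2) * (j : ℝ) ^ 2) ^ 2 = 4 * Real.pi ^ 2 * (j : ℝ) ^ 4 := by
    field_simp
    ring
  rw [h2]
  have : (0 : ℝ) < (j : ℝ) ^ 4 := by positivity
  nlinarith

lemma summable_gaussian_sq {r : ℝ} (hr : 0 < r) : Summable fun j => gaussian r j ^ 2 := by
  have h : Summable fun j : ℤ => r ^ 4 * (1 / (j : ℝ) ^ 4) :=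
    (Real.summable_one_div_int_pow.2 (by norm_num)).mul_left _
  refine h.of_norm_bounded_eventually ?_
  refine Set.Finite.subset (Set.finite_singleton (0 : ℤ)) fun j hj => ?_
  by_contra h0
  refine hj ?_
  change ‖gaussian r j ^ 2‖ ≤ r ^ 4 * (1 / (j : ℝ) ^ 4)
  rw [Real.norm_of_nonneg (by positivity), mul_one_div]
  exact gaussian_sq_le hr h0

/-- `∑ j, ρ_r(j)²` grows at most linearly in `r`. -/
lemma tsum_gaussian_sq_le {r₁ r₂ : ℝ} (h2 : 0 < r₂) (h : r₂ < r₁) :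
    r₂ / r₁ * ∑' j, gaussian r₁ j ^ 2 ≤ ∑' j, gaussian r₂ j ^ 2 := by
  have h1 : 0 < r₁ := h2.trans h
  -- Poisson summation: the sum is `r / √2` times a dual sum that decreases in `r`.
  have key {r : ℝ} (hr : 0 < r) : ∑' j, gaussian r j ^ 2 =
      r / √2 * ∑' j : ℤ, Real.exp (-(Real.pi * r ^ 2 / 2) * (j : ℝ) ^ 2) := by
    simp only [gaussian_sq]
    rw [Real.tsum_exp_neg_mul_int_sq (by positivity), ← Real.sqrt_eq_rpow,
      Real.sqrt_div (by norm_num), Real.sqrt_sq hr.le, one_div_div]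
    congr 1
    refine tsum_congr fun j => ?_
    congr 1
    field_simp
  have hsum {r : ℝ} (hr : 0 < r) :
      Summable fun j : ℤ => Real.exp (-(Real.pi * r ^ 2 / 2) * (j : ℝ) ^ 2) := by
    refine (summable_gaussian_sq (show 0 < 2 / r by positivity)).congr fun j => ?_
    rw [gaussian_sq]
    congr 1
    field_simp
  rw [key h1, key h2]
  have hle : ∑' j : ℤ, Real.exp (-(Real.pi * r₁ ^ 2 / 2) * (j : ℝ) ^ 2) ≤
      ∑' j : ℤ, Real.exp (-(Real.pi * r₂ ^ 2 / 2) * (j : ℝ) ^ 2) := by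
    refine (hsum h1).tsum_le_tsum (fun j => ?_) (hsum h2)
    gcongr
  calc r₂ / r₁ * (r₁ / √2 * ∑' j : ℤ, Real.exp (-(Real.pi * r₁ ^ 2 / 2) * (j : ℝ) ^ 2))
      = r₂ / √2 * ∑' j : ℤ, Real.exp (-(Real.pi * r₁ ^ 2 / 2) * (j : ℝ) ^ 2) := by
        field_simp
    _ ≤ _ := by gcongr

/-! ### Success probability of the reductions -/

lemma one_sub_chance_nonneg {p : ℝ} (hp : p ≤ 1) (m t : ℕ) : 0 ≤ 1 - chance p m t := by
  linarith [chance_le_one hp m t]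

lemma chance_mono {p q : ℝ} (h : p ≤ q) (hq : q ≤ 1) (m t : ℕ) :
    chance p m t ≤ chance q m t := by
  unfold chance
  split_ifs
  · exact le_rfl
  · have : (1 - q / 2) ^ m ≤ (1 - p / 2) ^ m := pow_le_pow_left₀ (by linarith) (by linarith) m
    have h2 : (0 : ℝ) ≤ 2 ^ t := by positivity
    nlinarith

/-- A lower bound for the success probability without assumptions on its sign. -/
lemma IsFilter.le_sampler {F : Prog} {M : ℕ → ℝ} {s : Fin n → ZMod N} {f g h : ℤ → ℝ}
    {p q : ℝ} [NeZero N] {ℓ ℓ' : ℕ} (hF : IsFilter F M s (amplitude f) h p) (hqp : q ≤ p)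
    (hq : 0 ≤ q) (hp1 : p ≤ 1) (hf : HasSum (fun j => amplitude f j ^ 2) 1)
    (hg : HasSum (fun j => amplitude g j ^ 2) 1)
    (hh : h = fun j => √p * amplitude g j) (hM3 : M 3 = ℓ) (hM4 : M 4 = ℓ')
    (x : Fin ℓ → Fin n → ZMod N) (O : Solver n N ℓ') {ε : ℝ}
    (hO : ∀ x, ε ≤ O.prob s (state g s x)) {c : Config} (hc : Frame M 0 0 [] c)
    (hψ : c.amp = Function.extend encode (state f s x) 0) :
    ε - (1 - chance q ℓ ℓ') ≤ (EDCP.sampler F).branchSum (O.branchProb s) c := by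
  have hch := one_sub_chance_nonneg (hqp.trans hp1) ℓ ℓ'
  -- For `ε ≤ 0` the bound is not positive. Otherwise `ε ≤ 1`, so multiplying by `chance` costs at
  -- most `1 - chance`.
  rcases le_total ε 0 with hε | hε
  · exact (by linarith : ε - (1 - chance q ℓ ℓ') ≤ 0).trans
      (Prog.branchSum_nonneg (O.branchProb_nonneg s) _ _)
  · let X : ℕ → Fin n → ZMod N := fun k => if hk : k < ℓ then x ⟨k, hk⟩ else 0
    have hX : ∀ k : Fin ℓ, X k = x k := fun k => by simp [X]
    have hε1 : ε ≤ 1 := (hO 0).trans (O.prob_state_le_one hg s 0)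
    have := hF.sampler (hq.trans hqp) hp1 hf hh hM3 hM4 X O hε hO hc
      (by rw [hψ]; exact isProduct_encode f s x X hX)
    have hm := chance_mono hqp hp1 ℓ ℓ'
    nlinarith [one_sub_chance_nonneg hp1 ℓ ℓ']

/-- The summand `1` of `digits` pays for rounding down, and `4 log (1 + r) ≥ 2 log₂ (1 + r)` since
`log 2 ≥ 1/2`. The factor `2^(κ + ℓ)` will make the truncation error small even after it is
multiplied by the number of samples. -/
lemma two_pow_digits {m : ℕ → ℝ} {κ ℓ : ℕ} {r : ℝ} (hr : 0 ≤ r) (h0 : m 0 = κ) (h3 : m 3 = ℓ)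
    (h5 : m 5 = r) : 2 ^ (κ + ℓ) * (1 + r) ^ 2 ≤ (2 : ℝ) ^ digits.addr m := by
  have hl : 0 ≤ Real.log (1 + r) := Real.log_nonneg (by linarith)
  have hv : digits.val m = κ + ℓ + 1 + 4 * Real.log (1 + r) := by
    simp only [digits, Expr.val_add, Expr.val_var, Expr.val_nat, Expr.val_mul, Expr.val_log, h0,
      h3, h5]
    push_cast
    ring
  have h1 : (κ : ℝ) + ℓ + 4 * Real.log (1 + r) ≤ digits.addr m := by
    have := Nat.lt_floor_add_one (digits.val m)
    rw [Expr.addr]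
    linarith
  rw [← Real.rpow_natCast 2 (digits.addr m)]
  refine le_trans ?_ (Real.rpow_le_rpow_of_exponent_le one_le_two h1)
  rw [Real.rpow_add two_pos, ← Nat.cast_add, Real.rpow_natCast]
  gcongr
  rw [Real.rpow_def_of_pos two_pos]
  calc (1 + r) ^ 2 = Real.exp (2 * Real.log (1 + r)) := by
        rw [two_mul, Real.exp_add, Real.exp_log (by linarith), sq]
    _ ≤ _ := by
      refine Real.exp_le_exp.2 ?_
      nlinarith [Real.log_two_gt_d9]

/-- The weight that the Gaussian filter produces. -/
def dampedGaussian (r₁ r₂ : ℝ) (L : ℕ) (j : ℤ) : ℝ :=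
  gaussian r₁ j * damping (1 / (r₂ * r₂) - 1 / (r₁ * r₁)) L j

lemma gaussian_decay_nonneg {r₁ r₂ : ℝ} (h2 : 0 < r₂) (h : r₂ < r₁) :
    0 ≤ 1 / (r₂ * r₂) - 1 / (r₁ * r₁) := by
  have h1 : 0 < r₁ := h2.trans h
  rw [sub_nonneg]
  gcongr

lemma gaussian_eq_mul {r₁ r₂ : ℝ} (h2 : 0 < r₂) (h : r₂ < r₁) (j : ℤ) :
    gaussian r₂ j = gaussian r₁ j *
      Real.exp (-(Real.pi * (1 / (r₂ * r₂) - 1 / (r₁ * r₁)) * (j : ℝ) ^ 2)) := by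
  have h1 : 0 < r₁ := h2.trans h
  rw [gaussian, gaussian, ← Real.exp_add]
  congr 1
  field_simp
  ring

lemma natAbs_sq (j : ℤ) : ((j.natAbs : ℕ) : ℝ) ^ 2 = (j : ℝ) ^ 2 := by
  rw [Nat.cast_natAbs, Int.cast_abs, sq_abs]

/-- Ignoring high digits can only weaken the damping. -/
lemma gaussian_le_damped {r₁ r₂ : ℝ} (h2 : 0 < r₂) (h : r₂ < r₁) (L : ℕ) (j : ℤ) :
    gaussian r₂ j ≤ dampedGaussian r₁ r₂ L j := by
  have hδ := gaussian_decay_nonneg h2 h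
  rw [gaussian_eq_mul h2 h, dampedGaussian, damping, ← natAbs_sq]
  have : (0 : ℝ) ≤ gaussian r₁ j := (Real.exp_pos _).le
  gcongr
  exact Nat.mod_le _ _

lemma damped_le_gaussian {r₁ r₂ : ℝ} (h2 : 0 < r₂) (h : r₂ < r₁) (L : ℕ) (j : ℤ) :
    dampedGaussian r₁ r₂ L j ≤ gaussian r₁ j := by
  have hδ := gaussian_decay_nonneg h2 h
  refine mul_le_of_le_one_right (Real.exp_pos _).le ?_
  rw [damping, Real.exp_le_one_iff, neg_nonpos]
  positivity

/-- The error of the Gaussian filter is due to the tail of the Gaussian. -/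
lemma damped_sq_sub_le {r₁ r₂ Q : ℝ} (h2 : 0 < r₂) (h : r₂ < r₁) (hQ : 0 < Q) {L : ℕ}
    (hL : Q * (1 + r₁) ^ 2 ≤ 2 ^ L) (j : ℤ) :
    dampedGaussian r₁ r₂ L j ^ 2 - gaussian r₂ j ^ 2 ≤ (Q ^ 2)⁻¹ * (1 / (j : ℝ) ^ 2) := by
  have h1 : 0 < r₁ := h2.trans h
  by_cases hj : j.natAbs < 2 ^ L
  · rw [dampedGaussian, damping, Nat.mod_eq_of_lt hj, natAbs_sq, ← gaussian_eq_mul h2 h, sub_self]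
    positivity
  · have hj0 : j ≠ 0 := by
      rintro rfl
      exact hj (by simp)
    -- Beyond the cutoff nothing is known about the damping except that it is at most `1`; the tail
    -- of `gaussian r₁` is small enough there.
    have hjL : Q * r₁ ^ 2 ≤ |(j : ℝ)| := by
      have : ((2 ^ L : ℕ) : ℝ) ≤ (j.natAbs : ℕ) := by exact_mod_cast not_lt.1 hj
      rw [Nat.cast_natAbs, Int.cast_abs] at this
      push_cast at this
      nlinarith
    have hjpos : (0 : ℝ) < (j : ℝ) ^ 2 := by positivity
    have hsq : Q ^ 2 * r₁ ^ 4 ≤ (j : ℝ) ^ 2 := by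
      rw [← sq_abs (j : ℝ)]
      calc Q ^ 2 * r₁ ^ 4 = (Q * r₁ ^ 2) ^ 2 := by ring
        _ ≤ _ := by gcongr
    calc dampedGaussian r₁ r₂ L j ^ 2 - gaussian r₂ j ^ 2 ≤ dampedGaussian r₁ r₂ L j ^ 2 := by
          linarith [sq_nonneg (gaussian r₂ j)]
      _ ≤ gaussian r₁ j ^ 2 := by
          have : 0 ≤ dampedGaussian r₁ r₂ L j := (Real.exp_pos _).le.trans (gaussian_le_damped h2 h L j)
          gcongr
          exact damped_le_gaussian h2 h L j
      _ ≤ r₁ ^ 4 / (j : ℝ) ^ 4 := gaussian_sq_le h1 hj0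
      _ ≤ (Q ^ 2)⁻¹ * (1 / (j : ℝ) ^ 2) := by
          rw [mul_one_div, inv_eq_one_div, div_div, div_le_div_iff₀ (by positivity) (by positivity)]
          nlinarith

/-- The success probability of the reduction for Gaussian weights. -/
lemma gaussian_success {ℓ ℓ' κ : ℕ} [NeZero N] {r₁ r₂ : ℝ} (h2 : 0 < r₂) (h : r₂ < r₁)
    (O : Solver n N ℓ') {ε : ℝ} (hO : O.SolvesWith (gaussian r₂) ε) :
    (sampler gaussianFilter).SolvesUsing O κ ℓ r₁ r₂ (gaussian r₁)
      (ε - (2 * √(2 * (ℓ' * ((((2 : ℝ) ^ (κ + ℓ)) ^ 2)⁻¹ * ∑' j : ℤ, 1 / (j : ℝ) ^ 2))) +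
        (1 - chance (r₂ / r₁) ℓ ℓ'))) := by
  intro s x
  have h1 : 0 < r₁ := h2.trans h
  set c₀ := initial κ n N ℓ ℓ' r₁ r₂ (state (gaussian r₁) s x) with hc₀
  set L := digits.addr c₀.mem with hLdef
  set g := dampedGaussian r₁ r₂ L with hgdef
  have hL := two_pow_digits (m := c₀.mem) (κ := κ) (ℓ := ℓ) h1.le rfl rfl rfl
  have h1s := (summable_gaussian_sq h1).hasSum
  have h2s := (summable_gaussian_sq h2).hasSum
  have hg0 : ∀ j, 0 ≤ g j := fun j => (Real.exp_pos _).le.trans (gaussian_le_damped h2 h L j)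
  have hgs : HasSum (fun j => g j ^ 2) (∑' j, g j ^ 2) :=
    (Summable.of_nonneg_of_le (fun _ => sq_nonneg _) (fun j => by
      gcongr
      exacts [hg0 j, damped_le_gaussian h2 h L j]) (summable_gaussian_sq h1)).hasSum
  set F₁ := ∑' j, gaussian r₁ j ^ 2
  set F₂ := ∑' j, gaussian r₂ j ^ 2
  set G := ∑' j, g j ^ 2
  have hF2 : 1 ≤ F₂ := by
    have := le_hasSum h2s 0 fun _ _ => sq_nonneg _
    simpa [gaussian] using this
  have hF2G : F₂ ≤ G := hasSum_le (fun j => by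
    gcongr
    exacts [(Real.exp_pos _).le, gaussian_le_damped h2 h L j]) h2s hgs
  have hGF1 : G ≤ F₁ := hasSum_le (fun j => by
    gcongr
    exacts [hg0 j, damped_le_gaussian h2 h L j]) hgs h1s
  have hF1 : 0 < F₁ := by linarith
  have hG : 0 < G := by linarith
  have hp0 : r₂ / r₁ ≤ G / F₁ := by
    rw [le_div_iff₀ hF1]
    exact (tsum_gaussian_sq_le h2 h).trans hF2G
  have hτ : G - F₂ ≤ (((2 : ℝ) ^ (κ + ℓ)) ^ 2)⁻¹ * ∑' j : ℤ, 1 / (j : ℝ) ^ 2 :=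
    hasSum_le (damped_sq_sub_le h2 h (by positivity) hL) (hgs.sub h2s)
      ((Real.summable_one_div_int_pow.2 one_lt_two).hasSum.mul_left _)
  have ha := hasSum_amplitude h1s hF1
  have hamp (z : ℤ) : amplitude (gaussian r₁) z *
      damping (1 / (r₂ * r₂) - 1 / (r₁ * r₁)) L z = √(G / F₁) * amplitude g z := by
    have e1 : √F₁ ≠ 0 := (Real.sqrt_pos.2 hF1).ne'
    have e2 : √G ≠ 0 := (Real.sqrt_pos.2 hG).ne'
    rw [amplitude, amplitude, h1s.tsum_eq, hgs.tsum_eq, Real.sqrt_div hG.le, hgdef, dampedGaussian]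
    field_simp
  have hp : HasSum (fun z => (amplitude (gaussian r₁) z *
      damping (1 / (r₂ * r₂) - 1 / (r₁ * r₁)) L z) ^ 2) (G / F₁) := by
    have := (hasSum_amplitude hgs hG).mul_left (G / F₁)
    rw [mul_one] at this
    refine hasSum_of_eq this fun z => ?_
    rw [hamp, mul_pow, Real.sq_sqrt (by positivity)]
  have hF := gaussianFilter_isFilter (M := c₀.mem) (n := n) rfl (gaussian_decay_nonneg h2 h)
    rfl s ha hp
  have := hF.le_sampler (g := g) hp0 (by positivity) ((div_le_one hF1).2 hGF1) ha
    (hasSum_amplitude hgs hG) (funext hamp) (ℓ := ℓ) (ℓ' := ℓ') rfl rfl x O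
    -- The solver is run on the truncated weight `g` instead of `gaussian r₂`; the subtracted term
    -- pays for that.
    (ε := ε - 2 * √(2 * (ℓ' * ((((2 : ℝ) ^ (κ + ℓ)) ^ 2)⁻¹ * ∑' j : ℤ, 1 / (j : ℝ) ^ 2))))
    (fun x' => le_trans (sub_le_sub_right (hO s x') _) (O.prob_state_le
      (fun j => (Real.exp_pos _).le) (gaussian_le_damped h2 h L) h2s hgs hF2 hτ s x'))
    (c := c₀) ⟨fun _ _ => rfl, by simp [hc₀, initial], by simp [hc₀, initial], rfl⟩ rfl
  rw [← sub_sub]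
  exact this

lemma hasSum_uniform_sq (M : ℕ) : HasSum (fun j => uniform M j ^ 2) M := by
  have : HasSum (fun j => uniform M j ^ 2) (∑ j ∈ Finset.Ico 0 (M : ℤ), uniform M j ^ 2) :=
    hasSum_sum_of_ne_finset_zero fun j hj => by
      have : ¬ (0 ≤ j ∧ j < (M : ℤ)) := by simpa using hj
      simp [uniform, this]
  rw [Finset.sum_congr rfl fun j hj => by
    rw [uniform, if_pos (by simpa using hj), one_pow]] at this
  simpa using this

/-- The reduction for uniform weights. -/
def uniformReduction : Prog := .seq storeDigits (sampler uniformFilter)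

lemma carry_eq_of_lt {m L : ℕ} {z : ℤ} (hm : m < 2 ^ L) (hz : z.natAbs < 2 ^ L) :
    carry m z L = decide (m < z.natAbs) := by
  rw [carry, Nat.mod_eq_of_lt hm, Nat.mod_eq_of_lt hz]

/-- The success probability of the reduction for uniform weights. -/
lemma uniform_success {ℓ ℓ' κ : ℕ} [NeZero N] {M₁ M₂ : ℕ} (h2 : 0 < M₂) (h : M₂ < M₁)
    (O : Solver n N ℓ') {ε : ℝ} (hO : O.SolvesWith (uniform M₂) ε) :
    uniformReduction.SolvesUsing O κ ℓ M₁ M₂ (uniform M₁)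
      (ε - (1 - chance ((M₂ : ℝ) / M₁) ℓ ℓ')) := by
  intro s x
  obtain ⟨m, rfl⟩ : ∃ m, M₂ = m + 1 := ⟨M₂ - 1, by omega⟩
  set c₀ := initial κ n N ℓ ℓ' M₁ ((m + 1 : ℕ) : ℝ) (state (uniform M₁) s x) with hc₀
  have h1R : (0 : ℝ) < M₁ := by exact_mod_cast h2.trans h
  have h2R : (0 : ℝ) < ((m + 1 : ℕ) : ℝ) := by positivity
  -- All `j` in the support have fewer binary digits than are treated, so the comparison is exact
  -- and there is no truncation error.
  have hL : M₁ < 2 ^ digits.addr c₀.mem := by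
    have := two_pow_digits (m := c₀.mem) (κ := κ) (ℓ := ℓ) h1R.le rfl rfl rfl
    have h3 : (1 : ℝ) ≤ 2 ^ (κ + ℓ) := one_le_pow₀ one_le_two
    have h4 : (M₁ : ℝ) < 2 ^ digits.addr c₀.mem := by
      refine lt_of_lt_of_le ?_ this
      nlinarith [mul_le_mul_of_nonneg_right h3 (sq_nonneg (1 + (M₁ : ℝ)))]
    exact_mod_cast h4
  have h1s := hasSum_uniform_sq M₁
  have h2s := hasSum_uniform_sq (m + 1)
  have ha := hasSum_amplitude h1s h1R
  have hb := hasSum_amplitude h2s h2R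
  have hamp (z : ℤ) : (if carry m z (digits.addr c₀.mem) = false then amplitude (uniform M₁) z
      else 0) = √(((m + 1 : ℕ) : ℝ) / M₁) * amplitude (uniform (m + 1)) z := by
    have e1 : √(M₁ : ℝ) ≠ 0 := (Real.sqrt_pos.2 h1R).ne'
    have e2 : √((m + 1 : ℕ) : ℝ) ≠ 0 := (Real.sqrt_pos.2 h2R).ne'
    rw [amplitude, amplitude, h1s.tsum_eq, h2s.tsum_eq, Real.sqrt_div h2R.le]
    by_cases hz : 0 ≤ z ∧ z < (M₁ : ℤ)
    · rw [carry_eq_of_lt (by omega) (by omega), uniform, if_pos hz, uniform]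
      by_cases hz2 : z < ((m + 1 : ℕ) : ℤ)
      · rw [if_pos (by rw [decide_eq_false_iff_not]; omega), if_pos ⟨hz.1, hz2⟩]
        field_simp
      · rw [if_neg (by rw [decide_eq_false_iff_not]; omega), if_neg fun h => hz2 h.2]
        simp
    · have hz' : ¬ (0 ≤ z ∧ z < ((m + 1 : ℕ) : ℤ)) := by omega
      rw [uniform, if_neg hz, uniform, if_neg hz']
      simp
  have hp : HasSum (fun z => (if carry m z (digits.addr c₀.mem) = false then
      amplitude (uniform M₁) z else 0) ^ 2) (((m + 1 : ℕ) : ℝ) / M₁) := by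
    have := hb.mul_left (((m + 1 : ℕ) : ℝ) / M₁)
    rw [mul_one] at this
    refine hasSum_of_eq this fun z => ?_
    rw [hamp, mul_pow, Real.sq_sqrt (by positivity)]
  change _ ≤ uniformReduction.branchSum (O.branchProb s) c₀
  rw [uniformReduction, Prog.branchSum_seq]
  refine le_storeDigits (m := m) rfl rfl (by omega) fun c hc => ?_
  have hdig : digits.addr c.mem = digits.addr c₀.mem := by
    simp [digits, Expr.addr, hc.mem 0 (by omega), hc.mem 3 (by omega), hc.mem 5 (by omega)]
  have hF := uniformFilter_isFilter (M := c.mem) (n := n) (m := m) (hc.mem 1 (by omega))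
    (fun i hi => hc.table i (Nat.zero_le i) (by rwa [hdig] at hi)) s ha
    (p := ((m + 1 : ℕ) : ℝ) / M₁) (by rw [hdig]; exact hp)
  rw [hdig] at hF
  refine hF.le_sampler (g := uniform (m + 1)) le_rfl (by positivity)
    ((div_le_one h1R).2 (by exact_mod_cast h.le)) ha hb (funext hamp) (ℓ := ℓ) (ℓ' := ℓ')
    (hc.mem 3 (by omega)) (hc.mem 4 (by omega)) x O (fun x' => hO s x') (c := c)
    ⟨fun _ _ => rfl, ?_, ?_, hc.out⟩ hc.amp
  · rw [hc.mem 7 (by omega)]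
    simp [hc₀, initial]
  · rw [hc.mem 9 (by omega)]
    simp [hc₀, initial]

/-! ### Asymptotic bounds -/

/-- The exponent is at most `t (log 2 - δ κ)`. Its second factor is not positive, so `t = 1` is the
worst case. -/
lemma one_sub_chance_le {p : ℝ} (hp1 : p ≤ 1) {m t : ℕ} {δ : ℝ} {κ : ℕ}
    (h : 2 * δ * κ * t ≤ p * m) (hκ : Real.log 2 ≤ δ * κ) :
    1 - chance p m t ≤ 2 * Real.exp (-(δ * κ)) := by
  rcases Nat.eq_zero_or_pos t with rfl | ht
  · simp [chance]
    positivity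
  · rw [chance, if_neg ht.ne', sub_sub_cancel]
    have ht' : (1 : ℝ) ≤ t := by exact_mod_cast ht
    have h1 : (1 - p / 2) ^ m ≤ Real.exp (-(p / 2)) ^ m :=
      pow_le_pow_left₀ (by linarith) (Real.one_sub_le_exp_neg _) m
    have h2 : (2 : ℝ) ^ t = Real.exp (t * Real.log 2) := by
      rw [Real.exp_nat_mul, Real.exp_log two_pos]
    calc (2 : ℝ) ^ t * (1 - p / 2) ^ m ≤ 2 ^ t * Real.exp (-(p / 2)) ^ m := by gcongr
      _ = Real.exp (t * Real.log 2 - p * m / 2) := by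
        rw [h2, ← Real.exp_nat_mul, ← Real.exp_add]
        congr 1
        ring
      _ ≤ Real.exp (Real.log 2 - δ * κ) := by
        refine Real.exp_le_exp.2 ?_
        nlinarith
      _ = 2 * Real.exp (-(δ * κ)) := by
        rw [sub_eq_add_neg, Real.exp_add, Real.exp_log two_pos]

/-- Almost surely, sufficiently many of the samples pass a filter. -/
lemma eventually_one_sub_chance_le {ℓ ℓ' : ℕ → ℕ} {c : ℝ} {ρ : ℕ → ℝ} (hρ1 : ∀ κ, 1 < ρ κ)
    (hρ : ρ =O[atTop] fun κ : ℕ => (κ : ℝ) ^ c)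
    (hℓ' : (fun κ : ℕ => (ℓ' κ : ℝ)) =O[atTop] fun κ : ℕ => (ℓ κ : ℝ) / (κ : ℝ) ^ (c + 1)) :
    ∃ b > 0, ∃ K ≥ 0, ∀ᶠ κ : ℕ in atTop,
      1 - chance (1 / ρ κ) (ℓ κ) (ℓ' κ) ≤ 2 * Real.exp (-(b * κ)) ∧ (ℓ' κ : ℝ) ≤ K * ℓ κ := by
  obtain ⟨C₁, hC₁, h1⟩ := hρ.exists_pos
  obtain ⟨C₂, hC₂, h2⟩ := hℓ'.exists_pos
  -- This rate is what `2 b κ ℓ' ≤ ℓ / ρ` requires: the powers `κ ^ c` cancel and one factor `κ`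
  -- remains.
  refine ⟨1 / (2 * (C₁ * C₂)), by positivity, C₁ * C₂, by positivity, ?_⟩
  have h3 : ∀ᶠ κ : ℕ in atTop, Real.log 2 ≤ 1 / (2 * (C₁ * C₂)) * κ :=
    (tendsto_natCast_atTop_atTop.const_mul_atTop (by positivity)).eventually_ge_atTop _
  filter_upwards [h1.bound, h2.bound, h3, eventually_ge_atTop 1] with κ h1 h2 h3 h4
  have hκ : (1 : ℝ) ≤ κ := by exact_mod_cast h4
  have hκ0 : (0 : ℝ) < κ := by linarith
  have hpow : 0 < (κ : ℝ) ^ c := Real.rpow_pos_of_pos hκ0 _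
  have hρ0 : 0 < ρ κ := by linarith [hρ1 κ]
  rw [Real.norm_of_nonneg hρ0.le, Real.norm_of_nonneg hpow.le] at h1
  rw [Real.rpow_add hκ0, Real.rpow_one, Real.norm_of_nonneg (by positivity),
    Real.norm_of_nonneg (by positivity), mul_div_assoc', le_div_iff₀ (by positivity)] at h2
  have h5 : (ℓ' κ : ℝ) * κ * ρ κ ≤ C₁ * C₂ * ℓ κ := by
    calc (ℓ' κ : ℝ) * κ * ρ κ ≤ ℓ' κ * κ * (C₁ * κ ^ c) := by gcongr
      _ = C₁ * (ℓ' κ * (κ ^ c * κ)) := by ring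
      _ ≤ C₁ * (C₂ * ℓ κ) := by gcongr
      _ = _ := by ring
  refine ⟨one_sub_chance_le ?_ ?_ h3, ?_⟩
  · rw [div_le_one hρ0]
    exact (hρ1 κ).le
  · rw [one_div_mul_eq_div, le_div_iff₀ hρ0]
    calc 2 * (1 / (2 * (C₁ * C₂))) * κ * ℓ' κ * ρ κ = (ℓ' κ * κ * ρ κ) / (C₁ * C₂) := by
          field_simp
      _ ≤ ℓ κ := by
          rw [div_le_iff₀ (by positivity)]
          linarith
  · refine le_trans ?_ h5
    have : (1 : ℝ) ≤ κ * ρ κ := by nlinarith [hρ1 κ]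
    rw [mul_assoc]
    exact le_mul_of_one_le_right (by positivity) this

lemma tendsto_polynomial_mul_exp_neg (P : Polynomial ℕ) {b : ℝ} (hb : 0 < b) :
    Tendsto (fun κ : ℕ => ((P.eval κ : ℕ) : ℝ) * Real.exp (-(b * κ))) atTop (𝓝 0) := by
  let Q : Polynomial ℝ := (P.map (Nat.castRingHom ℝ)).comp (Polynomial.C b⁻¹ * Polynomial.X)
  have h : Tendsto (fun κ : ℕ => b * (κ : ℝ)) atTop atTop :=
    tendsto_natCast_atTop_atTop.const_mul_atTop hb
  refine (Q.tendsto_div_exp_atTop.comp h).congr fun κ => ?_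
  have : (P.map (Nat.castRingHom ℝ)).eval (κ : ℝ) = ((P.eval κ : ℕ) : ℝ) := by
    simp
  simp only [Function.comp, Q, Polynomial.eval_comp, Polynomial.eval_mul, Polynomial.eval_C,
    Polynomial.eval_X, inv_mul_cancel_left₀ hb.ne', this, Real.exp_neg]
  rw [div_eq_mul_inv]

lemma Prog.SolvesUsing.mono {n N ℓ₂ : ℕ} {R : Prog} {O : Solver n N ℓ₂} {κ ℓ₁ : ℕ} {p₁ p₂ : ℝ}
    {f : ℤ → ℝ} {ε ε' : ℝ} (h : R.SolvesUsing O κ ℓ₁ p₁ p₂ f ε) (hε : ε' ≤ ε) :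
    R.SolvesUsing O κ ℓ₁ p₁ p₂ f ε' := fun s x => hε.trans (h s x)

/-- A program with exponentially small loss of success probability is a reduction. -/
lemma polyTimeReduction_of {α : Type} {toReal : α → ℝ} {f : α → ℤ → ℝ} {n N ℓ₁ ℓ₂ : ℕ → ℕ}
    {p₁ p₂ : ℕ → α} (hn : ∀ κ, 1 < n κ) (hN : ∀ κ, 1 < N κ)
    (hnN : PolyBounded fun κ => (n κ : ℝ) * Real.log (N κ)) (R : Prog)
    (hT : ∃ T : Polynomial ℕ, ∀ κ (s : Fin (n κ) → ZMod (N κ))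
      (x : Fin (ℓ₁ κ) → Fin (n κ) → ZMod (N κ)),
      ∀ c ∈ R.run (initial κ (n κ) (N κ) (ℓ₁ κ) (ℓ₂ κ) (toReal (p₁ κ)) (toReal (p₂ κ))
        (state (f (p₁ κ)) s x)), c.time ≤ T.eval κ)
    {u : ℕ → ℝ} {b K : ℝ} (hb : 0 < b) (hu : ∀ᶠ κ : ℕ in atTop, u κ ≤ K * Real.exp (-(b * κ)))
    (hR : ∀ κ (O : Solver (n κ) (N κ) (ℓ₂ κ)) (ε : ℝ), O.SolvesWith (f (p₂ κ)) ε →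
      R.SolvesUsing O κ (ℓ₁ κ) (toReal (p₁ κ)) (toReal (p₂ κ)) (f (p₁ κ)) (ε - u κ)) :
    PolyTimeReduction toReal f n N ℓ₁ ℓ₂ p₁ p₂ := by
  -- With this `a`, `2^(-a κ) = exp(-b κ / 2)`; the other half of the decay absorbs the constant
  -- `K`.
  refine ⟨R, hT, ⟨b / (2 * Real.log 2), by have := Real.log_pos one_lt_two; positivity, ?_⟩,
    fun O hO => ?_⟩
  · have h1 := tendsto_polynomial_mul_exp_neg 1 (half_pos hb)
    simp only [Polynomial.eval_one, Nat.cast_one, one_mul] at h1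
    have h2 := (h1.const_mul K).eventually_le_const (u := 1) (by simp)
    filter_upwards [hu, h2] with κ hu h2 O ε hO
    refine (hR κ O ε hO).mono (sub_le_sub_left (hu.trans ?_) _)
    have h3 : (2 : ℝ) ^ (-(b / (2 * Real.log 2) * κ)) = Real.exp (-(b / 2 * κ)) := by
      have := (Real.log_pos one_lt_two).ne'
      rw [Real.rpow_def_of_pos two_pos]
      congr 1
      field_simp
    have h4 : Real.exp (-(b * κ)) = Real.exp (-(b / 2 * κ)) * Real.exp (-(b / 2 * κ)) := by
      rw [← Real.exp_add]
      congr 1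
      ring
    rw [h3, h4, ← mul_assoc]
    exact mul_le_of_le_one_left (Real.exp_pos _).le h2
  · obtain ⟨C, hC, d, hO⟩ := hO
    obtain ⟨P, hP⟩ := hnN
    -- Half of the inverse polynomial pays for the loss, which is exponentially small while `n log
    -- N` is polynomial in `κ`.
    refine ⟨C / 2, by positivity, d, ?_⟩
    have h1 := (tendsto_polynomial_mul_exp_neg (P ^ d) hb).const_mul K
    rw [mul_zero] at h1
    have h2 := h1.eventually_le_const (u := C / 2) (by positivity)
    filter_upwards [hu, h2, hO] with κ hu h2 hO
    refine (hR κ (O κ) _ hO).mono ?_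
    have hx : 0 < (n κ : ℝ) * Real.log (N κ) :=
      mul_pos (by exact_mod_cast (zero_lt_one.trans (hn κ)))
        (Real.log_pos (by exact_mod_cast hN κ))
    set x := (n κ : ℝ) * Real.log (N κ)
    have hxP : x ^ d ≤ (((P ^ d).eval κ : ℕ) : ℝ) := by
      rw [Polynomial.eval_pow, Nat.cast_pow]
      exact pow_le_pow_left₀ hx.le (hP κ) d
    have h3 : u κ ≤ C / 2 * x⁻¹ ^ d := by
      rcases le_total (u κ) 0 with h0 | h0
      · exact h0.trans (by positivity)
      · rw [inv_pow, ← div_eq_mul_inv, le_div_iff₀ (by positivity)]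
        calc u κ * x ^ d ≤ u κ * (((P ^ d).eval κ : ℕ) : ℝ) := by gcongr
          _ ≤ K * Real.exp (-(b * κ)) * (((P ^ d).eval κ : ℕ) : ℝ) := by gcongr
          _ = K * ((((P ^ d).eval κ : ℕ) : ℝ) * Real.exp (-(b * κ))) := by ring
          _ ≤ C / 2 := h2
    linarith

/-! ### Run-time -/

lemma digits_addr_congr (m m' : ℕ → ℝ) (h : ∀ i < 7, m i = m' i) :
    digits.addr m = digits.addr m' := by
  simp [digits, Expr.addr, h]

lemma var_addr_congr {i : ℕ} (hi : i < 7) (m m' : ℕ → ℝ) (h : ∀ i < 7, m i = m' i) :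
    (Expr.var i).addr m = (Expr.var i).addr m' := by
  simp [Expr.addr, h i hi]

/-- This is why table addresses use the square of the index: `Tame` refers to arbitrary memories, in
which cell `10` may be negative. -/
lemma seven_le_tableCell (m : ℕ → ℝ) : 7 ≤ tableCell.addr m := by
  refine Nat.le_floor ?_
  simp only [tableCell, Expr.val_add, Expr.val_nat, Expr.val_mul, Expr.val_var]
  push_cast
  nlinarith [mul_self_nonneg (m 10)]

lemma tame_sampler {F : Prog} (hF : F.Tame) : (sampler F).Tame := by
  simpa [sampler, sampleStep, Prog.Tame, hF] using fun m m' => var_addr_congr (by norm_num) m m'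

lemma tame_gaussianFilter : gaussianFilter.Tame := by
  simpa [gaussianFilter, dampRow, dampPair, Prog.Tame] using digits_addr_congr

lemma tame_uniformReduction : uniformReduction.Tame := by
  refine ⟨?_, tame_sampler ?_⟩
  · simpa [storeDigits, Prog.Tame, seven_le_tableCell] using digits_addr_congr
  · simpa [uniformFilter, carryStep, notGate, Prog.Tame] using digits_addr_congr

lemma cost_gaussian_le {m : ℕ → ℝ} {ℓ L : ℕ} (hℓ : (Expr.var 3).addr m = ℓ)
    (hL : digits.addr m = L) :
    (sampler gaussianFilter).cost m ≤ 100 * ((1 + ℓ) * (1 + L) ^ 2) := by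
  simp only [sampler, sampleStep, gaussianFilter, dampRow, dampPair, Prog.cost, hℓ, hL,
    List.length_cons, List.length_nil]
  nlinarith [Nat.zero_le (ℓ * L), Nat.zero_le (ℓ * (L * L)), Nat.zero_le (L * L)]

lemma cost_uniform_le {m : ℕ → ℝ} {ℓ L : ℕ} (hℓ : (Expr.var 3).addr m = ℓ)
    (hL : digits.addr m = L) :
    uniformReduction.cost m ≤ 100 * ((1 + ℓ) * (1 + L) ^ 2) := by
  simp only [uniformReduction, storeDigits, sampler, sampleStep, uniformFilter, carryStep, notGate,
    Prog.cost, hℓ, hL, List.length_cons, List.length_nil]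
  nlinarith [Nat.zero_le (ℓ * L), Nat.zero_le (ℓ * (L * L)), Nat.zero_le (L * L)]

/-- Programs of polynomial cost run in polynomial time. -/
lemma exists_time_bound {n N ℓ ℓ' : ℕ → ℕ} {r₁ r₂ : ℕ → ℝ} {f : ℕ → ℤ → ℝ}
    (hℓ : PolyBounded fun κ => (ℓ κ : ℝ)) (hr : PolyBounded fun κ => Real.log (r₁ κ))
    (hr0 : ∀ κ, 0 < r₁ κ) {R : Prog} (hR : R.Tame)
    (hcost : ∀ (m : ℕ → ℝ) (ℓ L : ℕ), (Expr.var 3).addr m = ℓ → digits.addr m = L →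
      R.cost m ≤ 100 * ((1 + ℓ) * (1 + L) ^ 2)) :
    ∃ T : Polynomial ℕ, ∀ κ (s : Fin (n κ) → ZMod (N κ))
      (x : Fin (ℓ κ) → Fin (n κ) → ZMod (N κ)),
      ∀ c ∈ R.run (initial κ (n κ) (N κ) (ℓ κ) (ℓ' κ) (r₁ κ) (r₂ κ) (state (f κ) s x)),
        c.time ≤ T.eval κ := by
  obtain ⟨P, hP⟩ := hℓ
  obtain ⟨Q, hQ⟩ := hr
  refine ⟨100 * ((1 + P) * (1 + (Polynomial.X + P + 5 + 4 * Q)) ^ 2), fun κ s x c hc => ?_⟩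
  set c₀ := initial κ (n κ) (N κ) (ℓ κ) (ℓ' κ) (r₁ κ) (r₂ κ) (state (f κ) s x) with hc₀
  have h1 := (hR.run_le (m := c₀.mem) (fun _ _ => rfl) c hc).2
  have h3 : (Expr.var 3).addr c₀.mem = ℓ κ := by
    simp [Expr.addr, hc₀, initial]
  have h2 := hcost c₀.mem _ _ h3 rfl
  have hℓP : ℓ κ ≤ P.eval κ := Nat.cast_le.1 (hP κ)
  -- For `r₁ < 1` the logarithm of `r₁` is negative and gives no bound for `log (1 + r₁)`, hence the
  -- two cases.
  have hlog : Real.log (1 + r₁ κ) ≤ 1 + (Q.eval κ : ℕ) := by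
    have hl2 : Real.log 2 ≤ 1 := by linarith [Real.log_two_lt_d9]
    have hQ0 : (0 : ℝ) ≤ (Q.eval κ : ℕ) := Nat.cast_nonneg _
    rcases le_total (r₁ κ) 1 with h | h
    · have : Real.log (1 + r₁ κ) ≤ Real.log 2 :=
        Real.log_le_log (by linarith [hr0 κ]) (by linarith)
      linarith
    · have : Real.log (1 + r₁ κ) ≤ Real.log (2 * r₁ κ) :=
        Real.log_le_log (by linarith [hr0 κ]) (by linarith)
      rw [Real.log_mul two_ne_zero (hr0 κ).ne'] at this
      have := hQ κ
      simp only at this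
      linarith
  have hL : digits.addr c₀.mem ≤ κ + P.eval κ + 5 + 4 * Q.eval κ := by
    refine Nat.floor_le_of_le ?_
    have hℓP' : (ℓ κ : ℝ) ≤ (P.eval κ : ℕ) := hP κ
    have e0 : c₀.mem 0 = κ := rfl
    have e3 : c₀.mem 3 = ℓ κ := rfl
    have e5 : c₀.mem 5 = r₁ κ := rfl
    simp only [digits, Expr.val_add, Expr.val_var, Expr.val_nat, Expr.val_mul, Expr.val_log, e0,
      e3, e5]
    push_cast
    linarith
  have ht : c₀.time = 0 := rfl
  calc c.time ≤ R.cost c₀.mem := by omega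
    _ ≤ 100 * ((1 + ℓ κ) * (1 + digits.addr c₀.mem) ^ 2) := h2
    _ ≤ 100 * ((1 + P.eval κ) * (1 + (κ + P.eval κ + 5 + 4 * Q.eval κ)) ^ 2) := by gcongr
    _ = _ := by simp

/-- The factor `4^(-ℓ)` compensates for `ℓ' ≤ K ℓ`, and the root of `4^(-κ)` gives the exponential
decay. -/
lemma sqrt_error_le {K Z : ℝ} (hK : 0 ≤ K) (hZ : 0 ≤ Z) {κ ℓ ℓ' : ℕ} (h : (ℓ' : ℝ) ≤ K * ℓ) :
    2 * √(2 * (ℓ' * ((((2 : ℝ) ^ (κ + ℓ)) ^ 2)⁻¹ * Z))) ≤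
      2 * √(2 * (K * Z)) * Real.exp (-(Real.log 2 * κ)) := by
  have h1 : (ℓ : ℝ) ≤ (2 ^ ℓ) ^ 2 := by
    have : (ℓ : ℝ) ≤ 2 ^ ℓ := by exact_mod_cast ℓ.lt_two_pow_self.le
    have h2 : (1 : ℝ) ≤ 2 ^ ℓ := one_le_pow₀ one_le_two
    nlinarith
  have h2 : Real.exp (-(Real.log 2 * κ)) = ((2 : ℝ) ^ κ)⁻¹ := by
    rw [Real.exp_neg, mul_comm, Real.exp_nat_mul, Real.exp_log two_pos]
  have h3 : 2 * (ℓ' * ((((2 : ℝ) ^ (κ + ℓ)) ^ 2)⁻¹ * Z)) ≤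
      2 * (K * Z) * (((2 : ℝ) ^ κ)⁻¹) ^ 2 := by
    rw [pow_add, mul_pow, mul_inv]
    calc 2 * (ℓ' * (((((2 : ℝ) ^ κ) ^ 2)⁻¹ * ((2 ^ ℓ) ^ 2)⁻¹) * Z))
        ≤ 2 * (K * (2 ^ ℓ) ^ 2 * (((((2 : ℝ) ^ κ) ^ 2)⁻¹ * ((2 ^ ℓ) ^ 2)⁻¹) * Z)) := by
          gcongr
          exact h.trans (by gcongr)
      _ = _ := by field_simp
  rw [h2, mul_assoc]
  gcongr
  calc _ ≤ √(2 * (K * Z) * (((2 : ℝ) ^ κ)⁻¹) ^ 2) := Real.sqrt_le_sqrt h3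
    _ = _ := by rw [Real.sqrt_mul (by positivity), Real.sqrt_sq (by positivity)]

end EDCP

end

theorem mainTheorem9 (n N ℓ ℓ' : ℕ → ℕ) (c : ℝ)
    (hn : ∀ κ, 1 < n κ) (hN : ∀ κ, 1 < N κ) (hℓ : ∀ κ, 1 < ℓ κ)
    (hnN : EDCP.PolyBounded fun κ => (n κ : ℝ) * Real.log (N κ))
    (hℓ_poly : EDCP.PolyBounded fun κ => (ℓ κ : ℝ))
    (hℓ' : (fun κ : ℕ => (ℓ' κ : ℝ)) =O[atTop] fun κ : ℕ => (ℓ κ : ℝ) / (κ : ℝ) ^ (c + 1)) :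
    (∀ r₁ r₂ : ℕ → ℝ, (∀ κ, 0 < r₂ κ) → (∀ κ, r₂ κ < r₁ κ) →
      EDCP.PolyBounded (fun κ => Real.log (r₁ κ)) →
      ((fun κ : ℕ => r₁ κ / r₂ κ) =O[atTop] fun κ : ℕ => (κ : ℝ) ^ c) →
      EDCP.PolyTimeReduction id EDCP.gaussian n N ℓ ℓ' r₁ r₂) ∧
    (∀ M₁ M₂ : ℕ → ℕ, (∀ κ, 0 < M₂ κ) → (∀ κ, M₂ κ < M₁ κ) →
      EDCP.PolyBounded (fun κ => Real.log (M₁ κ)) →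
      ((fun κ : ℕ => (M₁ κ : ℝ) / (M₂ κ : ℝ)) =O[atTop] fun κ : ℕ => (κ : ℝ) ^ c) →
      EDCP.PolyTimeReduction Nat.cast EDCP.uniform n N ℓ ℓ' M₁ M₂) := by
  have (κ : ℕ) : NeZero (N κ) := ⟨(zero_lt_one.trans (hN κ)).ne'⟩
  refine ⟨fun r₁ r₂ h2 h hlog hO => ?_, fun M₁ M₂ h2 h hlog hO => ?_⟩
  · have h1 : ∀ κ, 0 < r₁ κ := fun κ => (h2 κ).trans (h κ)
    obtain ⟨b, hb, K, hK, hev⟩ := EDCP.eventually_one_sub_chance_le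
      (fun κ => (one_lt_div (h2 κ)).2 (h κ)) hO hℓ'
    have hl2 := Real.log_pos one_lt_two
    have hZ : 0 ≤ ∑' j : ℤ, 1 / (j : ℝ) ^ 2 := tsum_nonneg fun _ => by positivity
    -- Two losses add up, truncation with rate `log 2` and lack of samples with rate `b`; the
    -- smaller rate bounds both.
    refine EDCP.polyTimeReduction_of hn hN hnN (EDCP.sampler EDCP.gaussianFilter)
      (EDCP.exists_time_bound hℓ_poly hlog h1 (EDCP.tame_sampler EDCP.tame_gaussianFilter)
        fun m _ _ => EDCP.cost_gaussian_le) (lt_min hb hl2)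
      (K := 2 * √(2 * (K * ∑' j : ℤ, 1 / (j : ℝ) ^ 2)) + 2) ?_
      fun κ O ε hO => EDCP.gaussian_success (h2 κ) (h κ) O hO
    filter_upwards [hev] with κ hκ
    rw [one_div_div] at hκ
    rw [add_mul]
    refine add_le_add ((EDCP.sqrt_error_le hK hZ hκ.2).trans ?_) (hκ.1.trans ?_)
    · gcongr
      exact min_le_right _ _
    · gcongr
      exact min_le_left _ _
  · have h1 : ∀ κ, 0 < M₁ κ := fun κ => (h2 κ).trans (h κ)
    obtain ⟨b, hb, K, hK, hev⟩ := EDCP.eventually_one_sub_chance_le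
      (fun κ => (one_lt_div (by exact_mod_cast h2 κ)).2 (by exact_mod_cast h κ)) hO hℓ'
    refine EDCP.polyTimeReduction_of hn hN hnN EDCP.uniformReduction
      (EDCP.exists_time_bound hℓ_poly hlog (fun κ => by exact_mod_cast h1 κ)
        EDCP.tame_uniformReduction fun m _ _ => EDCP.cost_uniform_le) hb (K := 2) ?_
      fun κ O ε hO => EDCP.uniform_success (h2 κ) (h κ) O hO
    filter_upwards [hev] with κ hκ
    rw [one_div_div] at hκ
    exact hκ.1
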